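/- \textbf{Setting.} Let $m,n\ge 1$ and $p\ge n$ be integers. For $A\in M_k(\mathbb C)$ let $\|A\|$ be the operator norm and $|A|=(AA^*)^{1/2}$. Let $\iota(A)=\begin{pmatrix}A&0\\0&0\end{pmatrix}\in M_p(\mathbb C)$ for $A\in M_n(\mathbb C)$. Let $\mathrm{Chop}(t)=\max(-1,\min(t,1))$ for real $t$; for a square matrix $A$ with singular value decomposition $A=U\,\mathrm{diag}(s_i)\,V$ put $\mathrm{Chop}\,A=U\,\mathrm{diag}(\mathrm{Chop}(s_i))\,V$. For $f\colon\{-1,1\}^m\to M_n(\mathbb C)$ and $S\subseteq\{1,\dots,m\}$ let $\widehat f(S)=2^{-m}\sum_{\sigma\in\{-1,1\}^m} f(\sigma)\prod_{i\in S}\sigma_i$, let $\mathrm{Inf}_i f=\sum_{S\ni i}\mathrm{Tr}(\widehat f(S)\widehat f(S)^*)$, and for $X_1,\dots,X_m\in M_p(\mathbb C)$ and $0<\rho<1$ let $$Q_f^\iota(X_1,\dots,X_m)=\sum_{S}\iota(\widehat f(S))\prod_{i\in S}X_i,\qquad T_\rho Q_f^\iota(X_1,\dots,X_m)=\sum_{S}\rho^{|S|}\,\iota(\widehat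 f(S))\prod_{i\in S}X_i,$$ the factors being multiplied in increasing order of the index. Let $\mathcal G$ be the law of a random matrix $G\in M_n(\mathbb C)$ with $\mathbb E\,G=0$ and $\mathbb E\,GG^*=I$. Let $G_1,\dots,G_m$ have law $\mathcal G$, let $H_1,\dots,H_m$ be Haar-distributed random $p\times p$ unitary matrices, all of them independent, and for a function $F\colon M_p(\mathbb C)^m\to M_p(\mathbb C)$ put $$\|F\|_{L_2,\mathcal G}=\Big(\mathbb E\,\mathrm{Tr}\,\big|F(\iota(G_1)H_1,\dots,\iota(G_m)H_m)\big|^2\Big)^{1/2}.$$ \textbf{Statement.} For all $m,n\ge 1$ there is a constant $C=C(m,n)>0$ such that the following holds for all $p\ge n$, all laws $\mathcal G$ as above, all $c_2,c_3\ge 1$ such that $\mathbb E(GG^*)^2$ and $\mathbb E(GG^*)^3$ exist with $\|\mathbb E(GG^*)^2\|\le c_2$ and $\|\mathbb E(GG^*)^3\|\le c_3$, all $0<\rho<1$, and all $f\colon\{-1,1\}^m\to M_n(\mathbb C)$ with $\|f(\sigma)\|\le 1$ for every $\sigma$. Let $\tau=\max_{1\le i\le m}\mathrm{Inf}_i f$.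 Then the two $L_2$ norms below are finite, $$\frac1n\,\|Q_f^\iota\|_{L_2,\mathcal G}^2\le 1,$$ and $$\frac1n\,\big\|T_\rho Q_f^\iota-\mathrm{Chop}\,T_\rho Q_f^\iota\big\|_{L_2,\mathcal G}^2\;\le\;10\,n^{1/2}\,\tau^{\frac{1-\rho}{30\,c_2c_3}}+C\,\tau^{-1/3}\,p^{-1/2}.$$ (If $\tau=0$, the left-hand side of the last inequality is $0$.) -/

import Mathlib

open MeasureTheory
open scoped Matrix

noncomputable section

namespace NCMajorization

/-! ### Matrices -/

/-- Complex `n × n` matrices. -/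
abbrev Mat (n : ℕ) : Type := Matrix (Fin n) (Fin n) ℂ

/-- Operator norm (largest singular value) of a complex matrix, acting on Euclidean space. -/
def opNorm {n : ℕ} (A : Mat n) : ℝ := ‖Matrix.toEuclideanCLM (𝕜 := ℂ) A‖

/-- `Tr |A|² = Tr (A Aᴴ)`, a nonnegative real number. -/
def trSq {n : ℕ} (A : Mat n) : ℝ := (A * Aᴴ).trace.re

/-- The scalar truncation: `t` on `[-1, 1]`, `1` above, `-1` below. -/
def chopReal (t : ℝ) : ℝ := max (-1) (min t 1)

/-- `Chop A`: the truncation `chopReal` applied to the singular values of `A`, that is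
`Chop A = U diag(chopReal s) V` if `A = U diag(s) V` is a singular value decomposition (see
`chop_svd`). In closed form, `Chop A = g(A Aᴴ) A` with `g(t) = 1 / max(1, √t)`, since
`s / max(1, s) = chopReal s` for `s ≥ 0`. For Hermitian `A` this is `chopReal` applied to the
eigenvalues (see `chop_hermitian`). -/
def chop {n : ℕ} (A : Mat n) : Mat n := cfc (fun t : ℝ => (max 1 (√t))⁻¹) (A * Aᴴ) * A

/-- The embedding of `n × n` matrices in `p × p` matrices as the upper left corner (for `n ≤ p`). -/
def embed {n : ℕ} (p : ℕ) (A : Mat n) : Mat p :=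
  Matrix.of fun i j => if h : (i : ℕ) < n ∧ (j : ℕ) < n then A ⟨i, h.1⟩ ⟨j, h.2⟩ else 0

lemma chopReal_eq (t : ℝ) : chopReal t = (max 1 |t|)⁻¹ * t := by
  unfold chopReal
  rcases le_total t 1 with h1 | h1
  · rcases le_total (-1) t with h2 | h2
    · rw [min_eq_left h1, max_eq_right h2, max_eq_left (abs_le.2 ⟨h2, h1⟩)]; simp
    · rw [min_eq_left h1, max_eq_left h2, abs_of_nonpos (by linarith), max_eq_right (by linarith)]
      have : t ≠ 0 := by intro h; linarith
      field_simp
  · rw [min_eq_right h1, abs_of_nonneg (by linarith), max_eq_right h1]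
    have : t ≠ 0 := by intro h; linarith
    rw [inv_mul_cancel₀ this]; norm_num

lemma continuous_chopFactor : Continuous fun t : ℝ => (max 1 (√t))⁻¹ :=
  (continuous_const.max Real.continuous_sqrt).inv₀ fun t =>
    (lt_of_lt_of_le one_pos (le_max_left 1 (√t))).ne'

lemma cfc_conj_diagonal {n : ℕ} (U : Mat n) (hU : U ∈ Matrix.unitaryGroup (Fin n) ℂ)
    (a : Fin n → ℝ) (f : ℝ → ℝ) :
    cfc f (U * Matrix.diagonal (fun i => (a i : ℂ)) * Uᴴ) =
      U * Matrix.diagonal (fun i => (f (a i) : ℂ)) * Uᴴ := by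
  let D : (Fin n → ℝ) →⋆ₐ[ℝ] Mat n :=
    { toFun := fun b => U * Matrix.diagonal (fun i => (b i : ℂ)) * Uᴴ
      map_one' := by
        have h : U * Uᴴ = 1 := (Matrix.mem_unitaryGroup_iff).1 hU
        simp [h]
      map_mul' := fun b c => by
        have h : Uᴴ * U = 1 := (Matrix.mem_unitaryGroup_iff').1 hU
        have h2 : Matrix.diagonal (fun i => ((b * c) i : ℂ)) =
            Matrix.diagonal (fun i => (b i : ℂ)) * (Uᴴ * U) *
              Matrix.diagonal (fun i => (c i : ℂ)) := by
          rw [h]; simp [Matrix.diagonal_mul_diagonal]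
        rw [h2]; simp only [Matrix.mul_assoc]
      map_zero' := by simp
      map_add' := fun b c => by
        have h2 : Matrix.diagonal (fun i => ((b + c) i : ℂ)) =
            Matrix.diagonal (fun i => (b i : ℂ)) + Matrix.diagonal (fun i => (c i : ℂ)) := by
          simp [Matrix.diagonal_add]
        rw [h2, Matrix.mul_add, Matrix.add_mul]
      commutes' := fun r => by
        have h : U * Uᴴ = 1 := (Matrix.mem_unitaryGroup_iff).1 hU
        have h2 : Matrix.diagonal (fun i => ((algebraMap ℝ (Fin n → ℝ) r) i : ℂ)) =
            (r : ℂ) • (1 : Mat n) := by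
          ext i j; simp [Matrix.diagonal_apply, Matrix.one_apply]
        rw [h2]
        ext i j
        simp [h, Matrix.algebraMap_matrix_apply, Matrix.one_apply]
      map_star' := fun b => by
        simp [Matrix.star_eq_conjTranspose, Matrix.conjTranspose_mul, Matrix.mul_assoc,
          Matrix.diagonal_conjTranspose, Pi.star_def] }
  set B : Mat n := U * Matrix.diagonal (fun i => (a i : ℂ)) * Uᴴ with hB
  have hBD : D a = B := rfl
  have hBs : IsSelfAdjoint B := (IsSelfAdjoint.all a).map D
  let q : Polynomial ℝ := Lagrange.interpolate (Finset.univ.image a) id f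
  have hq : ∀ i, q.eval (a i) = f (a i) := fun i =>
    Lagrange.eval_interpolate_at_node (v := id) f (Set.injOn_id _)
      (Finset.mem_image_of_mem a (Finset.mem_univ i))
  have hspec : Set.EqOn f q.eval (spectrum ℝ B) := by
    intro x hx
    have hx' := AlgHom.spectrum_apply_subset D a hx
    rw [Pi.spectrum_eq] at hx'
    obtain ⟨i, hi⟩ := Set.mem_iUnion.1 hx'
    have : x = a i := by
      by_contra hne
      refine hi ?_
      exact isUnit_iff_ne_zero.2 (sub_ne_zero.2 hne)
    rw [this]
    exact (hq i).symm
  rw [cfc_congr hspec, cfc_polynomial q B hBs, ← hBD, Polynomial.aeval_algHom_apply]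
  have h3 : Polynomial.aeval a q = fun i => f (a i) := by
    ext i
    rw [← hq i]
    simp [Polynomial.aeval_def, Polynomial.eval₂_eq_eval_map]
  rw [h3]
  rfl

lemma chop_svd {n : ℕ} (U V : Mat n) (hU : U ∈ Matrix.unitaryGroup (Fin n) ℂ)
    (hV : V ∈ Matrix.unitaryGroup (Fin n) ℂ) (s : Fin n → ℝ) :
    chop (U * Matrix.diagonal (fun i => (s i : ℂ)) * V) =
      U * Matrix.diagonal (fun i => (chopReal (s i) : ℂ)) * V := by
  have hV1 : V * Vᴴ = 1 := (Matrix.mem_unitaryGroup_iff).1 hV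
  have hU1 : Uᴴ * U = 1 := (Matrix.mem_unitaryGroup_iff').1 hU
  set D : Mat n := Matrix.diagonal (fun i => (s i : ℂ)) with hD
  have hDD : D * Dᴴ = Matrix.diagonal (fun i => ((s i ^ 2 : ℝ) : ℂ)) := by
    rw [hD, Matrix.diagonal_conjTranspose, Matrix.diagonal_mul_diagonal]
    congr 1; ext i; simp [sq]
  have hA : (U * D * V) * (U * D * V)ᴴ =
      U * Matrix.diagonal (fun i => ((s i ^ 2 : ℝ) : ℂ)) * Uᴴ := by
    calc (U * D * V) * (U * D * V)ᴴ = U * (D * (V * Vᴴ) * Dᴴ) * Uᴴ := by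
          simp only [Matrix.conjTranspose_mul, Matrix.mul_assoc]
      _ = _ := by rw [hV1, Matrix.mul_one, hDD]
  unfold chop
  rw [hA, cfc_conj_diagonal U hU]
  calc _ = U * (Matrix.diagonal (fun i => (((max 1 (√(s i ^ 2)))⁻¹ : ℝ) : ℂ)) * (Uᴴ * U) * D) * V := by
        simp only [Matrix.mul_assoc]
    _ = _ := by
        rw [hU1, Matrix.mul_one, hD, Matrix.diagonal_mul_diagonal]
        congr 3; ext i
        rw [chopReal_eq, Real.sqrt_sq_eq_abs]; push_cast; ring

lemma chop_hermitian {n : ℕ} (A : Mat n) (hA : A.IsHermitian) : chop A = cfc chopReal A := by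
  have hc : Continuous fun t : ℝ => (max 1 |t|)⁻¹ :=
    (continuous_const.max continuous_abs).inv₀ fun t =>
      (lt_of_lt_of_le one_pos (le_max_left 1 |t|)).ne'
  have hA' : IsSelfAdjoint A := hA
  have h1 : A * Aᴴ = cfc (fun t : ℝ => t ^ 2) A := by
    rw [cfc_pow_id (R := ℝ) A 2, hA.eq, sq]
  unfold chop
  rw [h1, ← cfc_comp' (fun t : ℝ => (max 1 (√t))⁻¹) (fun t : ℝ => t ^ 2) A
    continuous_chopFactor.continuousOn]
  have h2 : chopReal = fun t : ℝ => (max 1 |t|)⁻¹ * t := funext chopReal_eq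
  rw [h2, cfc_mul (fun t : ℝ => (max 1 |t|)⁻¹) (fun t => t) A hc.continuousOn, cfc_id' ℝ A hA']
  simp only [Real.sqrt_sq_eq_abs]

/-! ### Fourier analysis on the cube `{-1, 1}^m` -/

/-- The Walsh function `W_S(σ) = ∏_{i ∈ S} σ_i`. -/
def walsh {m : ℕ} (S : Finset (Fin m)) (σ : Fin m → ℤˣ) : ℂ := ∏ i ∈ S, ((σ i : ℤ) : ℂ)

/-- The Fourier coefficient `2^{-m} ∑_σ f(σ) W_S(σ)`. -/
def fourierCoeff {m n : ℕ} (f : (Fin m → ℤˣ) → Mat n) (S : Finset (Fin m)) : Mat n :=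
  ((2 : ℂ) ^ m)⁻¹ • ∑ σ : Fin m → ℤˣ, walsh S σ • f σ

/-- The `i`-th influence `∑_{S ∋ i} Tr (f̂(S) f̂(S)ᴴ)`. -/
def influence {m n : ℕ} (f : (Fin m → ℤˣ) → Mat n) (i : Fin m) : ℝ :=
  ∑ S : Finset (Fin m) with i ∈ S, trSq (fourierCoeff f S)

/-- The maximal influence. -/
def maxInfluence {m n : ℕ} (f : (Fin m → ℤˣ) → Mat n) : ℝ := ⨆ i : Fin m, influence f i

/-! ### Noncommutative multilinear polynomials -/

/-- A noncommutative multilinear polynomial `∑_S Q̂(S) ∏_{i ∈ S} X_i` in `m` variables with `n × n`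
matrix coefficients, given by its family of coefficients. -/
abbrev NCPoly (m n : ℕ) : Type := Finset (Fin m) → Mat n

/-- The monomial `∏_{i ∈ S} X_i`, with factors in increasing order of the index. -/
def monomial {m n : ℕ} (S : Finset (Fin m)) (X : Fin m → Mat n) : Mat n :=
  ((S.sort (· ≤ ·)).map X).prod

/-- The value `Q(X_1, …, X_m) = ∑_S Q̂(S) ∏_{i ∈ S} X_i`. -/
def NCPoly.eval {m n : ℕ} (Q : NCPoly m n) (X : Fin m → Mat n) : Mat n :=
  ∑ S : Finset (Fin m), Q S * monomial S X

/-- The polynomial `Q_f` associated to `f`, with coefficients `f̂(S)`. -/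
def polyOf {m n : ℕ} (f : (Fin m → ℤˣ) → Mat n) : NCPoly m n := fun S => fourierCoeff f S

/-- The Ornstein-Uhlenbeck operator `T_ρ`: the coefficient of index `S` is multiplied by `ρ^|S|`. -/
def NCPoly.noise {m n : ℕ} (ρ : ℝ) (Q : NCPoly m n) : NCPoly m n := fun S => ((ρ : ℂ) ^ S.card) • Q S

/-- The polynomial `Q^ι` in `p × p` matrix variables, whose coefficients are the corner embeddings
of those of `Q`. -/
def NCPoly.embed {m n : ℕ} (p : ℕ) (Q : NCPoly m n) : NCPoly m p :=
  fun S => NCMajorization.embed p (Q S)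

/-! ### Random matrices -/

/-- The Borel `σ`-algebra (generated by the entries) on matrices. -/
instance instMeasurableSpaceMat (n : ℕ) : MeasurableSpace (Mat n) :=
  inferInstanceAs (MeasurableSpace (Fin n → Fin n → ℂ))

instance instBorelSpaceMat (n : ℕ) : BorelSpace (Mat n) :=
  inferInstanceAs (BorelSpace (Fin n → Fin n → ℂ))

instance instCompactSpaceUnitary (p : ℕ) : CompactSpace (Matrix.unitaryGroup (Fin p) ℂ) := by
  refine isCompact_iff_compactSpace.1 ?_
  refine IsCompact.of_isClosed_subset
    (s := {M : Mat p | ∀ i, M i ∈ {v : Fin p → ℂ | ∀ j, v j ∈ Metric.closedBall (0 : ℂ) 1}})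
    ?_ isClosed_unitary ?_
  · exact isCompact_pi_infinite fun _ => isCompact_pi_infinite fun _ => isCompact_closedBall 0 1
  · intro M hM i j
    simpa using entry_norm_bound_of_unitary hM i j

/-- The Haar probability measure on the group of `p × p` unitary matrices. -/
def haarUnitary (p : ℕ) : Measure (Matrix.unitaryGroup (Fin p) ℂ) := Measure.haarMeasure ⊤

instance instIsProbabilityMeasureHaarUnitary (p : ℕ) : IsProbabilityMeasure (haarUnitary p) where
  measure_univ := Measure.haarMeasure_self

/-- Entrywise integrability of a random matrix `X`. -/
def IntegrableMat {Ω : Type*} [MeasurableSpace Ω] {n : ℕ} (X : Ω → Mat n) (μ : Measure Ω) : Prop :=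
  ∀ i j, Integrable (fun ω => X ω i j) μ

/-- Entrywise expectation of a random matrix `X`. -/
def expMat {Ω : Type*} [MeasurableSpace Ω] {n : ℕ} (X : Ω → Mat n) (μ : Measure Ω) : Mat n :=
  Matrix.of fun i j => ∫ ω, X ω i j ∂μ

/-- `μ` is the law of a random matrix `G` with `E G = 0` and `E G Gᴴ = I`. -/
structure IsNormalizedLaw {n : ℕ} (μ : Measure (Mat n)) : Prop where
  isProbabilityMeasure : IsProbabilityMeasure μ
  integrable_id : IntegrableMat (fun G => G) μ
  integrable_sq : IntegrableMat (fun G => G * Gᴴ) μ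
  mean_eq_zero : expMat (fun G => G) μ = 0
  cov_eq_one : expMat (fun G => G * Gᴴ) μ = 1

/-- The joint law of independent `G_1, …, G_m` with law `μ` and, independently of these, independent
Haar distributed `p × p` unitary matrices `H_1, …, H_m`. -/
def jointLaw {n : ℕ} (m p : ℕ) (μ : Measure (Mat n)) :
    Measure ((Fin m → Mat n) × (Fin m → Matrix.unitaryGroup (Fin p) ℂ)) :=
  (Measure.pi fun _ => μ).prod (Measure.pi fun _ => haarUnitary p)

/-- The random `p × p` matrices `ι(G_i) H_i`. -/
def inputs {m n p : ℕ} (ω : (Fin m → Mat n) × (Fin m → Matrix.unitaryGroup (Fin p) ℂ)) :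
    Fin m → Mat p :=
  fun i => embed p (ω.1 i) * (ω.2 i : Mat p)

/-- `E Tr |F{ι(G_i) H_i}|² < ∞`, for a function `F` of `m` matrix variables. -/
def FiniteL2 {m n p : ℕ} (μ : Measure (Mat n)) (F : (Fin m → Mat p) → Mat p) : Prop :=
  Integrable (fun ω => trSq (F (inputs ω))) (jointLaw m p μ)

/-- The norm `‖F‖_{L₂,𝒢} = (E Tr |F{ι(G_i) H_i}|²)^{1/2}`. -/
def l2Norm {m n p : ℕ} (μ : Measure (Mat n)) (F : (Fin m → Mat p) → Mat p) : ℝ :=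
  √(∫ ω, trSq (F (inputs ω)) ∂(jointLaw m p μ))

end NCMajorization

end

/-!
The constant `C` may depend on `m` and `n`, and this makes the terms of degree at least two
harmless. Write `T = ∑_S ι(A(S)) ∏_{i ∈ S} ι(G_i) H_i` for the random matrix in question. Between
two factors `ι(·)` of rank at most `n`, a Haar unitary matrix `H_i` only contributes its `n × n`
corner, whose entries are of size `p^{-1/2}`. In second moments this is the identity
`E Tr |B H_i N|² = E Tr |B|² Tr |N|² / p` for `B`, `N` not involving `H_i`
(`mul_integral_trSq_mul_unitary_mul`), which is obtained by averaging over left translations of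
`H_i` by the finite set of signed cyclic shifts. Consequently

* the terms of `T` are orthogonal and the second moment of the term of index `S` is at most
  `Tr A(S) A(S)ᴴ` (`integral_trSq_eval_le`), which gives the bound for `Q` by Parseval's identity;
* in the expansion of `T Tᴴ` into products of two terms, all products are `O(p^{-1/2})` in mean,
  except the squares of the terms of degree at most one (`exists_integrable_bound`). Only
  second moments of `G_i` enter, so that the constants depend on `m` and `n` alone.

Up to this error, `T Tᴴ` is the corner embedding of
`A(∅) A(∅)ᴴ + ∑_i A({i}) G_i G_iᴴ A({i})ᴴ`. The mean of this matrix is at most `1` by Parseval's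
identity, and its fluctuation `∑_i A({i}) (G_i G_iᴴ - 1) A({i})ᴴ` is a sum of independent centred
matrices whose second moments add up to at most `c₂ ∑_i (Tr A({i}) A({i})ᴴ)² ≤ c₂ τ n`
(`integral_trSq_sum_fluct_le`). In an eigenbasis of `T Tᴴ` the squared distance from `T` to `Chop T`
is `∑_k (√y_k - 1)₊²`; here the fluctuation enters quadratically and the error linearly
(`trSq_sub_chop_le_of_eq`). So the normalized truncation error is at most
`c₂ τ / 4 + O(p^{-1/2})`. It is also at most `1`, and `min(1, c₂ τ / 4) ≤ 10 τ^e` for every exponent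
`0 ≤ e ≤ 1 / c₂` (`min_one_le_rpow`).
-/

noncomputable section

namespace NCMajorization

/-! ### The squared Frobenius norm `trSq` and the corner embedding -/

lemma trSq_eq_sum {n : ℕ} (A : Mat n) : trSq A = ∑ i, ∑ j, ‖A i j‖ ^ 2 := by
  simp only [trSq, Matrix.trace, Matrix.diag, Matrix.mul_apply, Matrix.conjTranspose_apply,
    Complex.re_sum]
  refine Finset.sum_congr rfl fun i _ => Finset.sum_congr rfl fun j _ => ?_
  rw [← Complex.normSq_eq_norm_sq, Complex.star_def, Complex.mul_conj, Complex.ofReal_re]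

lemma trSq_nonneg {n : ℕ} (A : Mat n) : 0 ≤ trSq A := by
  rw [trSq_eq_sum]; positivity

open scoped Matrix.Norms.Frobenius in
lemma trSq_eq_norm_sq {n : ℕ} (A : Mat n) : trSq A = ‖A‖ ^ 2 := by
  rw [trSq_eq_sum, Matrix.frobenius_norm_def, ← Real.sqrt_eq_rpow, Real.sq_sqrt (by positivity)]
  simp

open scoped Matrix.Norms.Frobenius in
/-- The Frobenius norm is submultiplicative. -/
lemma trSq_mul_le {n : ℕ} (A B : Mat n) : trSq (A * B) ≤ trSq A * trSq B := by
  simp only [trSq_eq_norm_sq, ← mul_pow]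
  exact pow_le_pow_left₀ (norm_nonneg _) (Matrix.frobenius_norm_mul A B) 2

open scoped Matrix.Norms.Frobenius in
lemma trSq_sum_le {n : ℕ} {ι : Type*} (s : Finset ι) (A : ι → Mat n) :
    trSq (∑ i ∈ s, A i) ≤ s.card * ∑ i ∈ s, trSq (A i) := by
  simp only [trSq_eq_norm_sq]
  exact (pow_le_pow_left₀ (norm_nonneg _) (norm_sum_le s A) 2).trans sq_sum_le_card_mul_sum_sq

lemma trSq_conjTranspose {n : ℕ} (A : Mat n) : trSq Aᴴ = trSq A := by
  simp only [trSq_eq_sum, Matrix.conjTranspose_apply, norm_star]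
  exact Finset.sum_comm

lemma trSq_smul {n : ℕ} (c : ℂ) (A : Mat n) : trSq (c • A) = ‖c‖ ^ 2 * trSq A := by
  simp only [trSq_eq_sum, Matrix.smul_apply, smul_eq_mul, norm_mul, mul_pow, Finset.mul_sum]

lemma trSq_one (n : ℕ) : trSq (1 : Mat n) = n := by simp [trSq]

lemma trSq_mul_unitary {n : ℕ} (A U : Mat n) (hU : U ∈ Matrix.unitaryGroup (Fin n) ℂ) :
    trSq (A * U) = trSq A := by
  have h : U * Uᴴ = 1 := Matrix.mem_unitaryGroup_iff.1 hU
  simp only [trSq, Matrix.conjTranspose_mul]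
  rw [Matrix.mul_assoc, ← Matrix.mul_assoc U, h, Matrix.one_mul]

lemma trSq_unitary_mul {n : ℕ} (A U : Mat n) (hU : U ∈ Matrix.unitaryGroup (Fin n) ℂ) :
    trSq (U * A) = trSq A := by
  rw [← trSq_conjTranspose, Matrix.conjTranspose_mul, trSq_mul_unitary, trSq_conjTranspose]
  exact Unitary.star_mem hU

lemma continuous_trSq {n : ℕ} : Continuous (trSq : Mat n → ℝ) := by
  simp only [funext trSq_eq_sum]; fun_prop

/-- Multiplication by `A` on the right enlarges the Euclidean norm of a row vector by a factor of at
most `opNorm A`. -/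
lemma sum_norm_sq_vecMul_le {n : ℕ} (A : Mat n) (v : Fin n → ℂ) :
    ∑ b, ‖(v ᵥ* A) b‖ ^ 2 ≤ opNorm A ^ 2 * ∑ a, ‖v a‖ ^ 2 := by
  open scoped Matrix.Norms.L2Operator in
  have h1 : ‖Aᴴ‖ = opNorm A := Matrix.l2_opNorm_conjTranspose A
  open scoped Matrix.Norms.L2Operator in
  have h2 := Matrix.l2_opNorm_mulVec Aᴴ (WithLp.toLp 2 (star v))
  rw [h1, EuclideanSpace.norm_eq, EuclideanSpace.norm_eq] at h2
  have h3 := pow_le_pow_left₀ (Real.sqrt_nonneg _) h2 2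
  rw [mul_pow, Real.sq_sqrt (by positivity), Real.sq_sqrt (by positivity)] at h3
  have h4 : Aᴴ *ᵥ star v = star (v ᵥ* A) := by
    rw [Matrix.star_vecMul]
  simpa [h4] using h3

lemma trSq_mul_le_opNorm {n : ℕ} (B A : Mat n) : trSq (B * A) ≤ opNorm A ^ 2 * trSq B := by
  rw [trSq_eq_sum, trSq_eq_sum, Finset.mul_sum]
  refine Finset.sum_le_sum fun i _ => ?_
  simpa [Matrix.mul_apply_eq_vecMul] using sum_norm_sq_vecMul_le A (B i)

lemma re_trace_mul_conjTranspose_le {n : ℕ} (A B : Mat n) {c : ℝ} (hc : 0 < c) :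
    (A * Bᴴ).trace.re ≤ (trSq A / c + c * trSq B) / 2 := by
  rw [trSq_eq_sum, trSq_eq_sum]
  simp only [Matrix.trace, Matrix.diag, Matrix.mul_apply, Matrix.conjTranspose_apply,
    Complex.re_sum, Finset.sum_div, Finset.mul_sum, ← Finset.sum_add_distrib]
  refine Finset.sum_le_sum fun i _ => Finset.sum_le_sum fun j _ => ?_
  have h1 : (A i j * star (B i j)).re ≤ ‖A i j‖ * ‖B i j‖ :=
    (Complex.re_le_norm _).trans (by rw [norm_mul, norm_star])
  refine h1.trans ?_
  have h2 : ‖A i j‖ ^ 2 / c + c * ‖B i j‖ ^ 2 - 2 * (‖A i j‖ * ‖B i j‖) =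
      (‖A i j‖ - c * ‖B i j‖) ^ 2 / c := by
    field_simp; ring
  have h3 : 0 ≤ (‖A i j‖ - c * ‖B i j‖) ^ 2 / c := by positivity
  linarith

lemma re_trace_conj_le {n : ℕ} (A K : Mat n) {c : ℝ} (hc : 0 < c) (hK : opNorm K ≤ c) :
    (A * K * Aᴴ).trace.re ≤ c * trSq A := by
  refine (re_trace_mul_conjTranspose_le (A * K) A hc).trans ?_
  have h : trSq (A * K) ≤ c ^ 2 * trSq A :=
    (trSq_mul_le_opNorm A K).trans (mul_le_mul_of_nonneg_right
      (pow_le_pow_left₀ (norm_nonneg _) hK 2) (trSq_nonneg A))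
  have h' : trSq (A * K) / c ≤ c * trSq A := by
    rw [div_le_iff₀ hc]; linarith [h]
  linarith

/-- The inclusion `ℂⁿ → ℂᵖ` onto the first `n` coordinates, as a matrix. -/
def incl (n p : ℕ) : Matrix (Fin p) (Fin n) ℂ := Matrix.of fun i a => if (i : ℕ) = a then 1 else 0

lemma incl_conjTranspose_mul_incl {n p : ℕ} (h : n ≤ p) : (incl n p)ᴴ * incl n p = 1 := by
  ext a b
  rw [Matrix.mul_apply, Finset.sum_eq_single (Fin.castLE h a)]
  · simp [incl, Matrix.one_apply, Fin.ext_iff]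
  · intro i _ hi
    have : ¬ (i : ℕ) = a := fun h' => hi (Fin.ext h')
    simp [incl, this]
  · simp

/-- The corner embedding is conjugation by a matrix that is isometric for `n ≤ p`. -/
lemma embed_eq {n p : ℕ} (A : Mat n) : embed p A = incl n p * A * (incl n p)ᴴ := by
  have key : ∀ (i : Fin p) (g : Fin n → ℂ), ∑ a, (incl n p) i a * g a =
      if h : (i : ℕ) < n then g ⟨i, h⟩ else 0 := by
    intro i g
    split_ifs with h
    · rw [Finset.sum_eq_single ⟨i, h⟩]
      · simp [incl]
      · intro b _ hb
        have : ¬ (i : ℕ) = b := fun h' => hb (Fin.ext h'.symm)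
        simp [incl, this]
      · simp
    · refine Finset.sum_eq_zero fun b _ => ?_
      have : ¬ (i : ℕ) = b := fun h' => h (h' ▸ b.2)
      simp [incl, this]
  have hs : ∀ (j : Fin p) (b : Fin n), (incl n p)ᴴ b j = (incl n p) j b := by
    intro j b; simp only [incl, Matrix.conjTranspose_apply, Matrix.of_apply]; split_ifs <;> simp
  ext i j
  simp only [Matrix.mul_assoc, Matrix.mul_apply (M := incl n p)]
  rw [key i]
  simp only [Matrix.mul_apply, hs, mul_comm (A _ _), embed, Matrix.of_apply]
  by_cases hi : (i : ℕ) < n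
  · by_cases hj : (j : ℕ) < n <;> simp [hi, hj, key]
  · simp [hi]

lemma embed_mul {n p : ℕ} (h : n ≤ p) (A B : Mat n) :
    embed p (A * B) = embed p A * embed p B := by
  simp only [embed_eq]
  calc _ = incl n p * A * (1 : Mat n) * B * (incl n p)ᴴ := by
        simp only [Matrix.mul_assoc, Matrix.one_mul]
    _ = _ := by rw [← incl_conjTranspose_mul_incl h]; simp only [Matrix.mul_assoc]

lemma embed_conjTranspose {n : ℕ} (p : ℕ) (A : Mat n) : embed p Aᴴ = (embed p A)ᴴ := by
  simp [embed_eq, Matrix.mul_assoc]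

lemma embed_sum {n : ℕ} (p : ℕ) {ι : Type*} (s : Finset ι) (A : ι → Mat n) :
    embed p (∑ i ∈ s, A i) = ∑ i ∈ s, embed p (A i) := by
  simp only [embed_eq, Matrix.mul_sum, Matrix.sum_mul]

lemma embed_add {n : ℕ} (p : ℕ) (A B : Mat n) : embed p (A + B) = embed p A + embed p B := by
  simp only [embed_eq, Matrix.mul_add, Matrix.add_mul]

lemma embed_zero (n p : ℕ) : embed p (0 : Mat n) = 0 := by
  simp only [embed_eq, Matrix.mul_zero, Matrix.zero_mul]

lemma embed_smul {n : ℕ} (p : ℕ) (c : ℂ) (A : Mat n) : embed p (c • A) = c • embed p A := by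
  simp only [embed_eq, Matrix.mul_smul, Matrix.smul_mul]

lemma trSq_embed {n p : ℕ} (h : n ≤ p) (A : Mat n) : trSq (embed p A) = trSq A := by
  rw [trSq, ← embed_conjTranspose, ← embed_mul h, embed_eq, Matrix.trace_mul_comm,
    ← Matrix.mul_assoc, incl_conjTranspose_mul_incl h, Matrix.one_mul, trSq]

lemma embed_one_apply {n p : ℕ} (i j : Fin p) :
    embed p (1 : Mat n) i j = if (i : ℕ) < n ∧ i = j then 1 else 0 := by
  by_cases hi : (i : ℕ) < n
  · by_cases hj : (j : ℕ) < n
    · simp [embed, hi, hj, Matrix.one_apply, Fin.ext_iff]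
    · have : i ≠ j := fun e => hj (e ▸ hi)
      simp [embed, hj, this]
  · simp [embed, hi]

lemma mul_embed_one_apply {n p : ℕ} (B : Mat p) (i j : Fin p) :
    (B * embed p (1 : Mat n)) i j = if (j : ℕ) < n then B i j else 0 := by
  rw [Matrix.mul_apply, Finset.sum_eq_single j]
  · rw [embed_one_apply]; simp
  · intro k _ hk; rw [embed_one_apply]; simp [hk]
  · simp

lemma trSq_mul_embed_one_le {n p : ℕ} (B : Mat p) : trSq (B * embed p (1 : Mat n)) ≤ trSq B := by
  rw [trSq_eq_sum, trSq_eq_sum]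
  refine Finset.sum_le_sum fun i _ => Finset.sum_le_sum fun j _ => ?_
  rw [mul_embed_one_apply]
  split_ifs
  · exact le_rfl
  · simp

lemma sum_norm_sq_vecMul_embed {n p : ℕ} (h : n ≤ p) (A : Mat n) (v : Fin p → ℂ) :
    ∑ b, ‖(v ᵥ* embed p A) b‖ ^ 2 = ∑ b, ‖((v ∘ Fin.castLE h) ᵥ* A) b‖ ^ 2 := by
  have hv : ∀ b : Fin p, (v ᵥ* embed p A) b =
      if hb : (b : ℕ) < n then ((v ∘ Fin.castLE h) ᵥ* A) ⟨b, hb⟩ else 0 := by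
    intro b
    simp only [Matrix.vecMul, dotProduct]
    rw [← Finset.sum_subset (Finset.subset_univ (Finset.univ.map (Fin.castLEEmb h)))]
    · split_ifs with hb <;> simp [Finset.sum_map, embed, hb]
    · intro i _ hi
      have : ¬ (i : ℕ) < n := fun hin => hi (by simpa using ⟨⟨i, hin⟩, rfl⟩)
      simp [embed, this]
  rw [← Finset.sum_subset (Finset.subset_univ (Finset.univ.map (Fin.castLEEmb h)))]
  · simp [Finset.sum_map, hv]
  · intro i _ hi
    have : ¬ (i : ℕ) < n := fun hin => hi (by simpa using ⟨⟨i, hin⟩, rfl⟩)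
    simp [hv, this]

lemma sum_norm_sq_comp_castLE_le {n p : ℕ} (h : n ≤ p) (v : Fin p → ℂ) :
    ∑ b, ‖(v ∘ Fin.castLE h) b‖ ^ 2 ≤ ∑ a, ‖v a‖ ^ 2 := by
  have := Finset.sum_le_sum_of_subset_of_nonneg (f := fun a => ‖v a‖ ^ 2)
    (Finset.subset_univ (Finset.univ.map (Fin.castLEEmb h))) (fun _ _ _ => by positivity)
  simpa [Finset.sum_map] using this

/-! ### The distance to `chop` -/

open scoped ComplexOrder in
/-- In an eigenbasis of `T Tᴴ` with eigenvalues `y_k`, the squared distance from `T` to `chop T` is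
`∑_k (√y_k - 1)₊²`. -/
lemma sub_chop_eq {n : ℕ} (T : Mat n) : ∃ U ∈ Matrix.unitaryGroup (Fin n) ℂ, ∃ y : Fin n → ℝ,
    (∀ k, 0 ≤ y k) ∧ (∀ k, (Uᴴ * (T * Tᴴ) * U) k k = y k) ∧
      trSq (T - chop T) = ∑ k, (1 - (max 1 √(y k))⁻¹) ^ 2 * y k := by
  have hps : (T * Tᴴ).PosSemidef := Matrix.posSemidef_self_mul_conjTranspose T
  set U : Mat n := (hps.isHermitian.eigenvectorUnitary : Mat n) with hUdef
  have hU : U ∈ Matrix.unitaryGroup (Fin n) ℂ := hps.isHermitian.eigenvectorUnitary.2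
  have hU1 : Uᴴ * U = 1 := Matrix.mem_unitaryGroup_iff'.1 hU
  set y := hps.isHermitian.eigenvalues with hy
  set h : ℝ → ℝ := fun t => (max 1 (√t))⁻¹ with hh
  have hY : T * Tᴴ = U * Matrix.diagonal (fun i => (y i : ℂ)) * Uᴴ :=
    hps.isHermitian.spectral_theorem
  have hD : Uᴴ * (T * Tᴴ) * U = Matrix.diagonal (fun i => (y i : ℂ)) := by
    rw [hY]
    calc _ = (Uᴴ * U) * Matrix.diagonal (fun i => (y i : ℂ)) * (Uᴴ * U) := by
          simp only [Matrix.mul_assoc]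
      _ = _ := by rw [hU1]; simp
  refine ⟨U, hU, y, fun k => hps.eigenvalues_nonneg k, fun k => by rw [hD]; simp, ?_⟩
  set D : Mat n := Matrix.diagonal (fun i => ((1 - h (y i) : ℝ) : ℂ)) with hDdef
  have h1 : T - chop T = U * D * Uᴴ * T := by
    have h2 : chop T = U * Matrix.diagonal (fun i => (h (y i) : ℂ)) * Uᴴ * T := by
      rw [chop, ← cfc_conj_diagonal U hU, ← hY]
    have h3 : D = 1 - Matrix.diagonal (fun i => (h (y i) : ℂ)) := by
      rw [hDdef, ← Matrix.diagonal_one, Matrix.diagonal_sub]; simp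
    have h4 : U * Uᴴ = 1 := Matrix.mem_unitaryGroup_iff.1 hU
    rw [h2, h3, Matrix.mul_sub, Matrix.sub_mul, Matrix.sub_mul, Matrix.mul_one, h4, Matrix.one_mul]
  have h5 : (T - chop T) * (T - chop T)ᴴ = U * (D * (Uᴴ * (T * Tᴴ) * U) * Dᴴ) * Uᴴ := by
    rw [h1]
    simp only [Matrix.conjTranspose_mul, Matrix.mul_assoc, Matrix.conjTranspose_conjTranspose]
  rw [trSq, h5, hD, Matrix.trace_mul_comm, ← Matrix.mul_assoc, hU1, Matrix.one_mul, hDdef,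
    Matrix.diagonal_conjTranspose, Matrix.diagonal_mul_diagonal, Matrix.diagonal_mul_diagonal,
    Matrix.trace_diagonal, Complex.re_sum]
  refine Finset.sum_congr rfl fun k _ => ?_
  simp only [Pi.star_apply, Complex.star_def, Complex.conj_ofReal, ← Complex.ofReal_mul,
    Complex.ofReal_re, hh]
  ring

lemma trSq_unitary_conj {n : ℕ} (U A : Mat n) (hU : U ∈ Matrix.unitaryGroup (Fin n) ℂ) :
    trSq (Uᴴ * A * U) = trSq A := by
  have hU' : Uᴴ ∈ Matrix.unitaryGroup (Fin n) ℂ := Unitary.star_mem hU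
  rw [trSq_mul_unitary _ _ hU, trSq_unitary_mul _ _ hU']

lemma sum_norm_sq_col_of_unitary {n : ℕ} {U : Mat n} (hU : U ∈ Matrix.unitaryGroup (Fin n) ℂ)
    (k : Fin n) : ∑ a, ‖U a k‖ ^ 2 = 1 := by
  have h := congrFun (congrFun (Matrix.mem_unitaryGroup_iff'.1 hU) k) k
  rw [Matrix.star_eq_conjTranspose, Matrix.mul_apply, Matrix.one_apply_eq] at h
  have h2 := congrArg Complex.re h
  rw [Complex.re_sum] at h2
  simpa [Complex.conj_mul', ← Complex.ofReal_pow] using h2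

lemma sum_norm_sq_row_of_unitary {n : ℕ} {U : Mat n} (hU : U ∈ Matrix.unitaryGroup (Fin n) ℂ)
    (a : Fin n) : ∑ k, ‖U a k‖ ^ 2 = 1 := by
  have h := sum_norm_sq_col_of_unitary (Unitary.star_mem hU) a
  simpa [Matrix.star_eq_conjTranspose] using h

/-- The diagonal of a matrix in any orthonormal basis is bounded in `ℓ₁` by its entries. -/
lemma sum_norm_diag_conj_le {n : ℕ} {U : Mat n} (hU : U ∈ Matrix.unitaryGroup (Fin n) ℂ)
    (E : Mat n) : ∑ k, ‖(Uᴴ * E * U) k k‖ ≤ ∑ a, ∑ b, ‖E a b‖ := by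
  have h1 : ∀ k, ‖(Uᴴ * E * U) k k‖ ≤ ∑ a, ∑ b, ‖E a b‖ * (‖U a k‖ * ‖U b k‖) := by
    intro k
    rw [Finset.sum_comm]
    simp only [Matrix.mul_apply, Finset.sum_mul]
    refine (norm_sum_le _ _).trans (Finset.sum_le_sum fun b _ => ?_)
    refine (norm_sum_le _ _).trans (Finset.sum_le_sum fun a _ => ?_)
    simp only [Matrix.conjTranspose_apply, norm_mul, norm_star]
    exact le_of_eq (by ring)
  refine (Finset.sum_le_sum fun k _ => h1 k).trans ?_
  rw [Finset.sum_comm]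
  refine Finset.sum_le_sum fun a _ => ?_
  rw [Finset.sum_comm]
  refine Finset.sum_le_sum fun b _ => ?_
  rw [← Finset.mul_sum]
  refine mul_le_of_le_one_right (norm_nonneg _) ?_
  have h2 : ∀ k, ‖U a k‖ * ‖U b k‖ ≤ (‖U a k‖ ^ 2 + ‖U b k‖ ^ 2) / 2 := fun k => by
    nlinarith [sq_nonneg (‖U a k‖ - ‖U b k‖)]
  refine (Finset.sum_le_sum fun k _ => h2 k).trans ?_
  rw [← Finset.sum_div, Finset.sum_add_distrib, sum_norm_sq_row_of_unitary hU,
    sum_norm_sq_row_of_unitary hU]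
  norm_num

/-- Truncation moves `T` by at most its own Frobenius norm. -/
lemma trSq_sub_chop_le {n : ℕ} (T : Mat n) : trSq (T - chop T) ≤ trSq T := by
  obtain ⟨U, hU, y, hy0, hy, hT⟩ := sub_chop_eq T
  have h1 : trSq T = ∑ k, y k := by
    have h4 : U * Uᴴ = 1 := Matrix.mem_unitaryGroup_iff.1 hU
    have h2 : (Uᴴ * (T * Tᴴ) * U).trace = (T * Tᴴ).trace := by
      rw [Matrix.trace_mul_comm, ← Matrix.mul_assoc, h4, Matrix.one_mul]
    rw [trSq, ← h2, Matrix.trace, Complex.re_sum]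
    exact Finset.sum_congr rfl fun k _ => by simp only [Matrix.diag]; rw [hy k, Complex.ofReal_re]
  rw [hT, h1]
  refine Finset.sum_le_sum fun k _ => mul_le_of_le_one_left (hy0 k) ?_
  have h5 : (1 : ℝ) ≤ max 1 √(y k) := le_max_left _ _
  have h6 : (max 1 √(y k))⁻¹ ≤ 1 := inv_le_one_of_one_le₀ h5
  have h7 : 0 ≤ (max 1 √(y k))⁻¹ := by positivity
  exact pow_le_one₀ (by linarith) (by linarith)

/-- The squared distance from `√y` to `[0, 1]` is at most `s² / 4 + |d|` as soon as `y ≤ 1 + s + d`: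
the part `s` enters quadratically because `√y - 1 ≤ (y - 1) / 2`. -/
lemma chopDefect_le {y s d : ℝ} (hy : 0 ≤ y) (h : y ≤ 1 + s + d) :
    (1 - (max 1 √y)⁻¹) ^ 2 * y ≤ s ^ 2 / 4 + |d| := by
  rcases le_total (√y) 1 with h1 | h1
  · rw [max_eq_left h1]; simp; positivity
  · rw [max_eq_right h1]
    have h2 : √y ^ 2 = y := Real.sq_sqrt hy
    set r := √y with hr
    have h3 : (1 - r⁻¹) ^ 2 * y = (r - 1) ^ 2 := by
      rw [← h2]; field_simp
    rw [h3]
    have hd := le_abs_self d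
    have hs := le_abs_self s
    have hs2 := sq_abs s
    -- With `t = r - 1`, the hypothesis reads `t² + 2 t ≤ s + d`. Either `t ≤ |s| / 2`, or `2 t`
    -- absorbs `s`.
    rcases le_total (r - 1) (|s| / 2) with h4 | h4
    · nlinarith [abs_nonneg d, abs_nonneg s]
    · nlinarith [sq_nonneg s]

/-- If `T Tᴴ = M + N + E` with `M ≤ 1`, then the truncation error of `T` is bounded by the square of
the Frobenius norm of `N` and the `ℓ₁` norm of the entries of `E`. -/
lemma trSq_sub_chop_le_of_eq {n : ℕ} (T M N E : Mat n) (hT : T * Tᴴ = M + N + E)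
    (hM : ∀ v : Fin n → ℂ, (star v ⬝ᵥ M *ᵥ v).re ≤ ∑ a, ‖v a‖ ^ 2) :
    trSq (T - chop T) ≤ trSq N / 4 + ∑ a, ∑ b, ‖E a b‖ := by
  obtain ⟨U, hU, y, hy0, hy, hTc⟩ := sub_chop_eq T
  have h1 : ∀ k, y k ≤ 1 + ((Uᴴ * N * U) k k).re + ((Uᴴ * E * U) k k).re := by
    intro k
    have h2 := congrArg Complex.re (hy k)
    rw [hT, Matrix.mul_add, Matrix.mul_add, Matrix.add_mul, Matrix.add_mul, Complex.ofReal_re] at h2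
    have h3 := hM (fun a => U a k)
    rw [sum_norm_sq_col_of_unitary hU k] at h3
    have h4 : (Uᴴ * M * U) k k = star (fun a => U a k) ⬝ᵥ M *ᵥ (fun a => U a k) := by
      rw [Matrix.mul_assoc, Matrix.mul_apply]
      rfl
    rw [← h4] at h3
    simp only [Matrix.add_apply, Complex.add_re] at h2
    linarith
  rw [hTc]
  refine (Finset.sum_le_sum fun k _ => chopDefect_le (hy0 k) (h1 k)).trans ?_
  rw [Finset.sum_add_distrib, ← Finset.sum_div]
  refine add_le_add (div_le_div_of_nonneg_right ?_ (by norm_num))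
    ((Finset.sum_le_sum fun k _ => Complex.abs_re_le_norm _).trans (sum_norm_diag_conj_le hU E))
  rw [← trSq_unitary_conj U N hU, trSq_eq_sum]
  refine Finset.sum_le_sum fun k _ => ?_
  refine le_trans ?_ (Finset.single_le_sum (f := fun j => ‖(Uᴴ * N * U) k j‖ ^ 2)
    (fun j _ => by positivity) (Finset.mem_univ k))
  rw [← sq_abs]
  exact pow_le_pow_left₀ (abs_nonneg _) (Complex.abs_re_le_norm _) 2

open scoped Matrix.Norms.L2Operator in
lemma continuous_chop {n : ℕ} : Continuous (chop : Mat n → Mat n) := by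
  have h : Continuous fun A : Mat n => cfc (fun t : ℝ => (max 1 (√t))⁻¹) (A * Aᴴ) :=
    Continuous.cfc_of_mem_nhdsSet (s := Set.univ) (fun t : ℝ => (max 1 (√t))⁻¹)
      Filter.univ_mem (continuous_id.mul continuous_star)
      (hf := continuous_chopFactor.continuousOn)
      (ha' := fun A => IsSelfAdjoint.mul_star_self A)
  exact h.mul continuous_id

/-! ### Orthogonality of Walsh functions -/

lemma sum_walsh_mul_walsh {m : ℕ} (S S' : Finset (Fin m)) :
    ∑ σ : Fin m → ℤˣ, walsh S σ * walsh S' σ = if S = S' then (2 : ℂ) ^ m else 0 := by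
  have h1 : ∀ σ : Fin m → ℤˣ, walsh S σ * walsh S' σ =
      ∏ i, ((if i ∈ S then (((σ i : ℤˣ) : ℤ) : ℂ) else 1) *
        if i ∈ S' then (((σ i : ℤˣ) : ℤ) : ℂ) else 1) := by
    intro σ
    rw [Finset.prod_mul_distrib, Finset.prod_ite_mem, Finset.prod_ite_mem, Finset.univ_inter,
      Finset.univ_inter, walsh, walsh]
  simp only [h1]
  rw [← Fintype.piFinset_univ, ← Finset.prod_univ_sum (fun _ => Finset.univ)
    (fun i (e : ℤˣ) => (if i ∈ S then ((e : ℤ) : ℂ) else 1) * if i ∈ S' then ((e : ℤ) : ℂ) else 1)]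
  have h2 : (Finset.univ : Finset ℤˣ) = {1, -1} := rfl
  have h3 : ∀ i, ∑ e : ℤˣ, ((if i ∈ S then ((e : ℤ) : ℂ) else 1) *
      if i ∈ S' then ((e : ℤ) : ℂ) else 1) = if (i ∈ S ↔ i ∈ S') then 2 else 0 := by
    intro i
    rw [h2, Finset.sum_pair (by decide)]
    by_cases h : i ∈ S <;> by_cases h' : i ∈ S' <;> simp [h, h'] <;> norm_num
  simp only [h3]
  split_ifs with h
  · subst h; simp
  · obtain ⟨i, hi⟩ : ∃ i, ¬ (i ∈ S ↔ i ∈ S') := by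
      by_contra hc; push Not at hc; exact h (Finset.ext hc)
    exact Finset.prod_eq_zero (Finset.mem_univ i) (by simp [hi])

lemma conj_walsh {m : ℕ} (S : Finset (Fin m)) (σ : Fin m → ℤˣ) : star (walsh S σ) = walsh S σ := by
  simp [walsh]

lemma sum_walsh_mul_walsh' {m : ℕ} (σ σ' : Fin m → ℤˣ) :
    ∑ S, walsh S σ * walsh S σ' = if σ = σ' then (2 : ℂ) ^ m else 0 := by
  have h1 : ∀ S : Finset (Fin m), walsh S σ * walsh S σ' =
      ∏ i ∈ S, ((((σ i : ℤˣ) : ℤ) : ℂ) * (((σ' i : ℤˣ) : ℤ) : ℂ)) := fun S => by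
    rw [Finset.prod_mul_distrib, walsh, walsh]
  simp only [h1]
  rw [← Finset.powerset_univ, ← Finset.prod_one_add]
  split_ifs with h
  · subst h
    have h2 : ∀ e : ℤˣ, (1 : ℂ) + ((e : ℤ) : ℂ) * ((e : ℤ) : ℂ) = 2 := by
      intro e; rcases Int.units_eq_one_or e with rfl | rfl <;> norm_num
    simp [h2]
  · obtain ⟨i, hi⟩ := Function.ne_iff.1 h
    refine Finset.prod_eq_zero (Finset.mem_univ i) ?_
    rcases Int.units_eq_one_or (σ i) with h2 | h2 <;>
      rcases Int.units_eq_one_or (σ' i) with h3 | h3 <;> simp_all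

/-- Parseval's identity for a Walsh expansion. -/
lemma sum_norm_sq_walsh {m : ℕ} (z : Finset (Fin m) → ℂ) :
    ∑ σ : Fin m → ℤˣ, ‖∑ S, walsh S σ * z S‖ ^ 2 = 2 ^ m * ∑ S, ‖z S‖ ^ 2 := by
  have key : ∑ σ : Fin m → ℤˣ, (∑ S, walsh S σ * z S) * star (∑ S, walsh S σ * z S) =
      2 ^ m * ∑ S, z S * star (z S) := by
    simp only [star_sum, star_mul', conj_walsh, Finset.sum_mul_sum]
    rw [Finset.sum_comm, Finset.mul_sum]
    refine Finset.sum_congr rfl fun S _ => ?_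
    rw [Finset.sum_comm]
    have : ∀ S', ∑ σ : Fin m → ℤˣ, walsh S σ * z S * (walsh S' σ * star (z S')) =
        (if S = S' then (2 : ℂ) ^ m else 0) * (z S * star (z S')) := fun S' => by
      rw [← sum_walsh_mul_walsh, Finset.sum_mul]
      exact Finset.sum_congr rfl fun σ _ => by ring
    simp only [this]
    simp
  have h2 := congrArg Complex.re key
  simp only [Complex.star_def, Complex.mul_conj'] at h2
  exact_mod_cast h2

/-- The Fourier inversion formula on the cube. -/
lemma sum_walsh_smul_fourierCoeff {m n : ℕ} (f : (Fin m → ℤˣ) → Mat n) (σ : Fin m → ℤˣ) :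
    ∑ S, walsh S σ • fourierCoeff f S = f σ := by
  simp only [fourierCoeff, smul_comm (walsh _ σ), ← Finset.smul_sum]
  simp only [Finset.smul_sum (r := walsh _ σ), smul_smul (walsh _ σ)]
  rw [Finset.sum_comm]
  simp only [← Finset.sum_smul, sum_walsh_mul_walsh', ite_smul, zero_smul]
  simp [smul_smul]

/-- The Walsh coefficients of a family of contractions satisfy `∑_S f̂(S) f̂(S)ᴴ ≤ 1`. -/
lemma sum_norm_sq_vecMul_fourierCoeff_le {m n : ℕ} (f : (Fin m → ℤˣ) → Mat n)
    (hf : ∀ σ, opNorm (f σ) ≤ 1) (v : Fin n → ℂ) :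
    ∑ S, ∑ b, ‖(v ᵥ* fourierCoeff f S) b‖ ^ 2 ≤ ∑ a, ‖v a‖ ^ 2 := by
  have h1 : ∀ σ b, (v ᵥ* f σ) b = ∑ S, walsh S σ * (v ᵥ* fourierCoeff f S) b := by
    intro σ b
    conv_lhs => rw [← sum_walsh_smul_fourierCoeff f σ, Matrix.vecMul_sum]
    simp [Matrix.vecMul_smul]
  have h2 : 2 ^ m * ∑ S, ∑ b, ‖(v ᵥ* fourierCoeff f S) b‖ ^ 2 =
      ∑ σ, ∑ b, ‖(v ᵥ* f σ) b‖ ^ 2 := by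
    rw [Finset.sum_comm, Finset.sum_comm (s := (Finset.univ : Finset (Fin m → ℤˣ))),
      Finset.mul_sum]
    refine Finset.sum_congr rfl fun b _ => ?_
    rw [← sum_norm_sq_walsh]
    exact Finset.sum_congr rfl fun σ _ => by rw [h1]
  have h3 : ∑ σ, ∑ b, ‖(v ᵥ* f σ) b‖ ^ 2 ≤ ∑ σ : Fin m → ℤˣ, ∑ a, ‖v a‖ ^ 2 := by
    refine Finset.sum_le_sum fun σ _ => (sum_norm_sq_vecMul_le (f σ) v).trans ?_
    exact mul_le_of_le_one_left (by positivity) (pow_le_one₀ (norm_nonneg _) (hf σ))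
  rw [← h2] at h3
  have h4 : (Fintype.card (Fin m → ℤˣ) : ℝ) = 2 ^ m := by simp
  rw [Finset.sum_const, Finset.card_univ, nsmul_eq_mul, h4] at h3
  exact le_of_mul_le_mul_left h3 (by positivity)

/-- Averaging over signs decouples the terms of a matrix-valued Walsh expansion. -/
lemma sum_trSq_walsh {m p : ℕ} (t : Finset (Fin m) → Mat p) :
    ∑ σ : Fin m → ℤˣ, trSq (∑ S, walsh S σ • t S) = 2 ^ m * ∑ S, trSq (t S) := by
  simp only [trSq_eq_sum, Matrix.sum_apply, Matrix.smul_apply, smul_eq_mul]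
  rw [Finset.sum_comm, Finset.sum_comm (s := (Finset.univ : Finset (Finset (Fin m)))),
    Finset.mul_sum]
  refine Finset.sum_congr rfl fun i _ => ?_
  rw [Finset.sum_comm, Finset.sum_comm (s := (Finset.univ : Finset (Finset (Fin m)))),
    Finset.mul_sum]
  exact Finset.sum_congr rfl fun j _ => sum_norm_sq_walsh _

/-! ### Averaging over a finite set of unitary matrices -/

lemma walsh_singleton {m : ℕ} (i : Fin m) (σ : Fin m → ℤˣ) : walsh {i} σ = ((σ i : ℤ) : ℂ) := by
  simp [walsh]

/-- Orthogonality of signs, as Parseval's identity for a Walsh expansion supported on singletons. -/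
lemma sum_norm_sq_signs {p : ℕ} (z : Fin p → ℂ) :
    ∑ s : Fin p → ℤˣ, ‖∑ c, ((s c : ℤ) : ℂ) * z c‖ ^ 2 = 2 ^ p * ∑ c, ‖z c‖ ^ 2 := by
  classical
  let ζ : Finset (Fin p) → ℂ := fun S => ∑ c, if S = {c} then z c else 0
  have h1 : ∀ (F : Finset (Fin p) → ℂ), ∑ S, F S * ζ S = ∑ c, F {c} * z c := by
    intro F
    simp only [ζ, Finset.mul_sum]
    rw [Finset.sum_comm]
    simp
  have h3 : ∀ c, ζ {c} = z c := fun c => by simp [ζ]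
  have h4 : ∑ S, ‖ζ S‖ ^ 2 = ∑ c, ‖z c‖ ^ 2 := by
    have h5 := h1 (fun S => star (ζ S))
    simp only [h3, Complex.star_def, Complex.conj_mul'] at h5
    exact_mod_cast h5
  rw [← h4, ← sum_norm_sq_walsh ζ]
  refine Finset.sum_congr rfl fun s _ => ?_
  rw [h1]
  simp [walsh_singleton]

/-- The signed cyclic shift `e_{c + k} ↦ s_c e_c` of `ℂᵖ`. -/
def signedShift {p : ℕ} (s : Fin p → ℤˣ) (k : Fin p) : Mat p :=
  Matrix.of fun c d => if d = c + k then ((s c : ℤ) : ℂ) else 0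

lemma signedShift_mem {p : ℕ} [NeZero p] (s : Fin p → ℤˣ) (k : Fin p) :
    signedShift s k ∈ Matrix.unitaryGroup (Fin p) ℂ := by
  rw [Matrix.mem_unitaryGroup_iff]
  ext c d
  have h : ∀ e : ℤˣ, ((e : ℤ) : ℂ) * ((e : ℤ) : ℂ) = 1 := by
    intro e; rcases Int.units_eq_one_or e with rfl | rfl <;> norm_num
  rw [Matrix.mul_apply, Finset.sum_eq_single (c + k)]
  · by_cases hcd : c = d
    · subst hcd; simp [signedShift, h]
    · simp [signedShift, hcd]
  · intro e _ he; simp [signedShift, he]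
  · simp

/-- The signs remove the off-diagonal terms and the shifts average the diagonal, so that the signed
shifts average like the full unitary group on quadratic expressions. -/
lemma sum_trSq_mul_signedShift_mul {p : ℕ} [NeZero p] (B N : Mat p) :
    ∑ s : Fin p → ℤˣ, ∑ k, trSq (B * signedShift s k * N) = 2 ^ p * (trSq B * trSq N) := by
  have h1 : ∀ (s : Fin p → ℤˣ) (k a b : Fin p), (B * signedShift s k * N) a b =
      ∑ c, ((s c : ℤ) : ℂ) * (B a c * N (c + k) b) := by
    intro s k a b
    rw [Matrix.mul_assoc, Matrix.mul_apply]
    refine Finset.sum_congr rfl fun c _ => ?_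
    rw [Matrix.mul_apply, Finset.sum_eq_single (c + k)]
    · simp [signedShift]; ring
    · intro e _ he; simp [signedShift, he]
    · simp
  have h2 : ∀ k, ∑ s : Fin p → ℤˣ, trSq (B * signedShift s k * N) =
      2 ^ p * ∑ a, ∑ c, ‖B a c‖ ^ 2 * ∑ b, ‖N (c + k) b‖ ^ 2 := by
    intro k
    simp only [trSq_eq_sum, h1]
    rw [Finset.sum_comm, Finset.mul_sum]
    refine Finset.sum_congr rfl fun a _ => ?_
    have h4 : ∑ c, ‖B a c‖ ^ 2 * ∑ b, ‖N (c + k) b‖ ^ 2 =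
        ∑ b, ∑ c, ‖B a c‖ ^ 2 * ‖N (c + k) b‖ ^ 2 := by
      simp only [Finset.mul_sum]; exact Finset.sum_comm
    rw [Finset.sum_comm, h4, Finset.mul_sum]
    refine Finset.sum_congr rfl fun b _ => ?_
    rw [sum_norm_sq_signs]
    simp only [norm_mul, mul_pow]
  have h3 : ∀ c, ∑ k, ∑ b, ‖N (c + k) b‖ ^ 2 = trSq N := by
    intro c
    rw [trSq_eq_sum]
    exact Equiv.sum_comp (Equiv.addLeft c) (fun d => ∑ b, ‖N d b‖ ^ 2)
  rw [Finset.sum_comm]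
  simp only [h2, ← Finset.mul_sum]
  congr 1
  calc _ = ∑ a, ∑ c, ‖B a c‖ ^ 2 * ∑ k, ∑ b, ‖N (c + k) b‖ ^ 2 := by
        rw [Finset.sum_comm]
        refine Finset.sum_congr rfl fun a _ => ?_
        rw [Finset.sum_comm]
        simp only [Finset.mul_sum]
    _ = _ := by
        simp only [h3, trSq_eq_sum B, Finset.sum_mul]

/-! ### Moments of a normalized law -/

instance instSecondCountableTopologyMat (n : ℕ) : SecondCountableTopology (Mat n) :=
  inferInstanceAs (SecondCountableTopology (Fin n → Fin n → ℂ))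

instance instSecondCountableTopologyUnitary (p : ℕ) :
    SecondCountableTopology (Matrix.unitaryGroup (Fin p) ℂ) :=
  TopologicalSpace.Subtype.secondCountableTopology _

lemma linearMap_apply_eq_sum {n : ℕ} (φ : Mat n →ₗ[ℂ] ℂ) (A : Mat n) :
    φ A = ∑ i, ∑ j, A i j * φ (Matrix.single i j 1) := by
  conv_lhs => rw [Matrix.matrix_eq_sum_single A]
  simp only [map_sum]
  refine Finset.sum_congr rfl fun i _ => Finset.sum_congr rfl fun j _ => ?_
  rw [← smul_eq_mul, ← map_smul, Matrix.smul_single, smul_eq_mul, mul_one]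

lemma IntegrableMat.integrable_linearMap {Ω : Type*} [MeasurableSpace Ω] {μ : Measure Ω} {n : ℕ}
    {X : Ω → Mat n} (hX : IntegrableMat X μ) (φ : Mat n →ₗ[ℂ] ℂ) :
    Integrable (fun ω => φ (X ω)) μ := by
  rw [funext fun ω => linearMap_apply_eq_sum φ (X ω)]
  exact integrable_finsetSum _ fun i _ => integrable_finsetSum _ fun j _ => (hX i j).mul_const _

lemma IntegrableMat.integral_linearMap {Ω : Type*} [MeasurableSpace Ω] {μ : Measure Ω} {n : ℕ}
    {X : Ω → Mat n} (hX : IntegrableMat X μ) (φ : Mat n →ₗ[ℂ] ℂ) :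
    ∫ ω, φ (X ω) ∂μ = φ (expMat X μ) := by
  rw [funext fun ω => linearMap_apply_eq_sum φ (X ω), linearMap_apply_eq_sum φ (expMat X μ),
    integral_finsetSum _ fun i _ => integrable_finsetSum _ fun j _ => (hX i j).mul_const _]
  refine Finset.sum_congr rfl fun i _ => ?_
  rw [integral_finsetSum _ fun j _ => (hX i j).mul_const _]
  refine Finset.sum_congr rfl fun j _ => ?_
  rw [integral_mul_const]
  rfl

/-- The functional `A ↦ Tr (B ι(A) Bᴴ)`. -/
def traceConj {n p : ℕ} (B : Mat p) : Mat n →ₗ[ℂ] ℂ where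
  toFun A := (B * embed p A * Bᴴ).trace
  map_add' A A' := by simp [embed_add, Matrix.mul_add, Matrix.add_mul]
  map_smul' c A := by simp [embed_smul]

lemma trSq_mul_embed_eq {n p : ℕ} (h : n ≤ p) (B : Mat p) (G : Mat n) :
    trSq (B * embed p G) = (traceConj B (G * Gᴴ)).re := by
  simp [traceConj, trSq, embed_mul h, embed_conjTranspose, Matrix.mul_assoc]

section Law

variable {n : ℕ} {μ : Measure (Mat n)}

lemma IsNormalizedLaw.integrable_trSq_mul (hμ : IsNormalizedLaw μ) {p : ℕ} (h : n ≤ p)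
    (B : Mat p) : Integrable (fun G : Mat n => trSq (B * embed p G)) μ := by
  simp only [trSq_mul_embed_eq h]
  exact (hμ.integrable_sq.integrable_linearMap (traceConj B)).re

lemma IsNormalizedLaw.integral_trSq_mul (hμ : IsNormalizedLaw μ) {p : ℕ} (h : n ≤ p) (B : Mat p) :
    ∫ G, trSq (B * embed p G) ∂μ = trSq (B * embed p (1 : Mat n)) := by
  simp only [trSq_mul_embed_eq h]
  have h1 := integral_re (hμ.integrable_sq.integrable_linearMap (traceConj B))
  rw [hμ.integrable_sq.integral_linearMap, hμ.cov_eq_one] at h1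
  simpa using h1

lemma embed_self (A : Mat n) : embed n A = A := by
  ext i j; simp [embed]

lemma IsNormalizedLaw.integrable_trSq (hμ : IsNormalizedLaw μ) : Integrable trSq μ := by
  have := hμ.integrable_trSq_mul le_rfl 1
  simpa only [Matrix.one_mul, embed_self] using this

lemma IsNormalizedLaw.integral_trSq (hμ : IsNormalizedLaw μ) : ∫ G, trSq G ∂μ = n := by
  have := hμ.integral_trSq_mul le_rfl 1
  simpa only [Matrix.one_mul, embed_self, trSq_one] using this

end Law

/-! ### Symmetries of the joint law -/

section Joint

variable {m n p : ℕ}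

instance instIsMulLeftInvariantHaarUnitary (p : ℕ) : (haarUnitary p).IsMulLeftInvariant :=
  inferInstanceAs (Measure.haarMeasure ⊤).IsMulLeftInvariant

lemma continuous_inputs (i : Fin m) :
    Continuous fun ω : (Fin m → Mat n) × (Fin m → Matrix.unitaryGroup (Fin p) ℂ) => inputs ω i := by
  simp only [inputs, embed_eq]
  fun_prop

lemma continuous_prod_inputs (l : List (Fin m)) :
    Continuous fun ω : (Fin m → Mat n) × (Fin m → Matrix.unitaryGroup (Fin p) ℂ) =>
      (l.map (inputs ω)).prod := by
  induction l with
  | nil => simpa using continuous_const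
  | cons i l ih =>
    simp only [List.map_cons, List.prod_cons]
    exact (continuous_inputs i).mul ih

variable {μ : Measure (Mat n)} [IsProbabilityMeasure μ]

instance instIsProbabilityMeasureJointLaw : IsProbabilityMeasure (jointLaw m p μ) := by
  unfold jointLaw; infer_instance

lemma measurePreserving_mul_left_jointLaw (U : Fin m → Matrix.unitaryGroup (Fin p) ℂ) :
    MeasurePreserving (fun ω : (Fin m → Mat n) × (Fin m → Matrix.unitaryGroup (Fin p) ℂ) =>
      (ω.1, U * ω.2)) (jointLaw m p μ) (jointLaw m p μ) :=
  (MeasurePreserving.id _).prod (measurePreserving_mul_left _ U)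

/-- Averaging over finitely many left translations of the unitary matrices. -/
lemma card_mul_integral_eq {κ : Type*} [Fintype κ] (U : κ → Fin m → Matrix.unitaryGroup (Fin p) ℂ)
    {F : (Fin m → Mat n) × (Fin m → Matrix.unitaryGroup (Fin p) ℂ) → ℝ}
    (hF : Integrable F (jointLaw m p μ)) :
    Fintype.card κ * ∫ ω, F ω ∂(jointLaw m p μ) =
      ∫ ω, ∑ k, F (ω.1, U k * ω.2) ∂(jointLaw m p μ) := by
  have h1 := fun k => measurePreserving_mul_left_jointLaw (μ := μ) (U k)
  have h0 : ∀ k, Integrable (fun ω => F (ω.1, U k * ω.2)) (jointLaw m p μ) := fun k =>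
    (h1 k).integrable_comp_of_integrable hF
  rw [integral_finsetSum _ fun k _ => h0 k]
  have h2 : ∀ k, ∫ ω, F (ω.1, U k * ω.2) ∂(jointLaw m p μ) = ∫ ω, F ω ∂(jointLaw m p μ) := by
    intro k
    have h3 := integral_map (h1 k).measurable.aemeasurable
      (by rw [(h1 k).map_eq]; exact hF.aestronglyMeasurable)
    rw [(h1 k).map_eq] at h3
    exact h3.symm
  simp [h2]

/-- A Haar unitary `H_i` between two factors independent of it decouples them:
`E w Tr |B H_i N|² = E w Tr |B|² Tr |N|² / p`. -/
lemma mul_integral_trSq_mul_unitary_mul [NeZero p] (i : Fin m) (w : (Fin m → Mat n) → ℝ)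
    (B : (Fin m → Mat n) → Mat p)
    (N : (Fin m → Mat n) × (Fin m → Matrix.unitaryGroup (Fin p) ℂ) → Mat p)
    (hN : ∀ ω U, N (ω.1, Pi.mulSingle i U * ω.2) = N ω)
    (hint : Integrable (fun ω => w ω.1 * trSq (B ω.1 * (ω.2 i : Mat p) * N ω)) (jointLaw m p μ)) :
    p * ∫ ω, w ω.1 * trSq (B ω.1 * (ω.2 i : Mat p) * N ω) ∂(jointLaw m p μ) =
      ∫ ω, w ω.1 * (trSq (B ω.1) * trSq (N ω)) ∂(jointLaw m p μ) := by
  have h1 := card_mul_integral_eq (κ := (Fin p → ℤˣ) × Fin p)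
    (fun κ => Pi.mulSingle i ⟨signedShift κ.1 κ.2, signedShift_mem κ.1 κ.2⟩) hint
  have h2 : ∀ ω : (Fin m → Mat n) × (Fin m → Matrix.unitaryGroup (Fin p) ℂ),
      ∑ κ : (Fin p → ℤˣ) × Fin p, w ω.1 * trSq (B ω.1 *
        (((Pi.mulSingle i ⟨signedShift κ.1 κ.2, signedShift_mem κ.1 κ.2⟩ * ω.2 :
          Fin m → Matrix.unitaryGroup (Fin p) ℂ) i : Matrix.unitaryGroup (Fin p) ℂ) : Mat p) *
        N (ω.1, Pi.mulSingle i ⟨signedShift κ.1 κ.2, signedShift_mem κ.1 κ.2⟩ * ω.2)) =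
      2 ^ p * (w ω.1 * (trSq (B ω.1) * trSq (N ω))) := by
    intro ω
    simp only [hN, Pi.mul_apply, Pi.mulSingle_eq_same, Submonoid.coe_mul]
    rw [← Finset.mul_sum, Fintype.sum_prod_type]
    have h3 := sum_trSq_mul_signedShift_mul (B ω.1) ((ω.2 i : Mat p) * N ω)
    rw [trSq_unitary_mul _ _ (ω.2 i).2] at h3
    simp only [Matrix.mul_assoc] at h3 ⊢
    rw [h3]; ring
  simp only [h2] at h1
  rw [integral_const_mul] at h1
  have h4 : (Fintype.card ((Fin p → ℤˣ) × Fin p) : ℝ) = 2 ^ p * p := by simp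
  rw [h4, mul_assoc] at h1
  exact mul_left_cancel₀ (by positivity) h1

lemma integrable_prod_coord {g : Fin m → Mat n → ℝ} (hg : ∀ j, Integrable (g j) μ) :
    Integrable (fun ω => ∏ j, g j (ω.1 j)) (jointLaw m p μ) :=
  (Integrable.fintype_prod (f := g) hg).comp_fst _

lemma integral_prod_coord (g : Fin m → Mat n → ℝ) :
    ∫ ω, ∏ j, g j (ω.1 j) ∂(jointLaw m p μ) = ∏ j, ∫ x, g j x ∂μ := by
  have := integral_fun_fst (μ := Measure.pi fun _ : Fin m => μ)
    (ν := Measure.pi fun _ : Fin m => haarUnitary p) (fun x => ∏ j, g j (x j))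
  rw [jointLaw, this, integral_fintype_prod_eq_prod]
  simp

lemma integral_fst (g : (Fin m → Mat n) → ℝ) :
    ∫ ω, g ω.1 ∂(jointLaw m p μ) = ∫ x, g x ∂(Measure.pi fun _ => μ) := by
  have := integral_fun_fst (μ := Measure.pi fun _ : Fin m => μ)
    (ν := Measure.pi fun _ : Fin m => haarUnitary p) g
  rw [jointLaw, this]
  simp

end Joint

/-! ### Second moments of monomials -/

section Moments

variable {m n p : ℕ}

lemma trSq_inputs (h : n ≤ p) (ω : (Fin m → Mat n) × (Fin m → Matrix.unitaryGroup (Fin p) ℂ))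
    (i : Fin m) : trSq (inputs ω i) = trSq (ω.1 i) := by
  rw [inputs, trSq_mul_unitary _ _ (ω.2 i).2, trSq_embed h]

lemma trSq_mul_prod_inputs_le (h : n ≤ p)
    (ω : (Fin m → Mat n) × (Fin m → Matrix.unitaryGroup (Fin p) ℂ)) (l : List (Fin m)) (B : Mat p) :
    trSq (B * (l.map (inputs ω)).prod) ≤ trSq B * (l.map fun j => trSq (ω.1 j)).prod := by
  induction l generalizing B with
  | nil => simp
  | cons i l ih =>
    simp only [List.map_cons, List.prod_cons, ← Matrix.mul_assoc]
    refine (ih _).trans ?_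
    rw [← mul_assoc]
    refine mul_le_mul_of_nonneg_right ?_ (List.prod_nonneg ?_)
    · exact (trSq_mul_le _ _).trans_eq (by rw [trSq_inputs h])
    · simp only [List.mem_map]; rintro _ ⟨j, _, rfl⟩; exact trSq_nonneg _

lemma prod_map_trSq_eq {l : List (Fin m)} (hl : l.Nodup) (x : Fin m → Mat n) :
    (l.map fun j => trSq (x j)).prod = ∏ j, if j ∈ l then trSq (x j) else 1 := by
  rw [← List.prod_toFinset _ hl, Finset.prod_ite, Finset.prod_const_one, mul_one]
  refine Finset.prod_congr ?_ fun _ _ => rfl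
  ext j; simp

lemma prod_inputs_mulSingle_mul {l : List (Fin m)} {i : Fin m} (hi : i ∉ l)
    (ω : (Fin m → Mat n) × (Fin m → Matrix.unitaryGroup (Fin p) ℂ))
    (U : Matrix.unitaryGroup (Fin p) ℂ) :
    (l.map (inputs (ω.1, Pi.mulSingle i U * ω.2))).prod = (l.map (inputs ω)).prod := by
  congr 1
  refine List.map_congr_left fun j hj => ?_
  have : j ≠ i := fun e => hi (e ▸ hj)
  simp [inputs, Pi.mulSingle_eq_of_ne this]

variable {μ : Measure (Mat n)} [IsProbabilityMeasure μ]

lemma integrable_weight_mul_trSq (hμ : IsNormalizedLaw μ) (h : n ≤ p) {l : List (Fin m)}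
    (hl : l.Nodup) (f : Fin m → Mat n → ℝ) (hf0 : ∀ j x, 0 ≤ f j x) (hfc : ∀ j, Continuous (f j))
    (hfi : ∀ j, Integrable (f j) μ) (hf1 : ∀ j ∈ l, f j = 1) (B : Mat p) :
    Integrable (fun ω => (∏ j, f j (ω.1 j)) * trSq (B * (l.map (inputs ω)).prod))
      (jointLaw m p μ) := by
  have h1 : Integrable (fun ω => (∏ j, (if j ∈ l then trSq else f j) (ω.1 j)) * trSq B)
      (jointLaw m p μ) := by
    refine (integrable_prod_coord (g := fun j => if j ∈ l then trSq else f j)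
      fun j => ?_).mul_const _
    split_ifs
    exacts [hμ.integrable_trSq, hfi j]
  refine h1.mono' ?_ (Filter.Eventually.of_forall fun ω => ?_)
  · refine Continuous.aestronglyMeasurable (Continuous.mul ?_ ?_)
    · exact continuous_finsetProd _ fun j _ =>
        (hfc j).comp ((continuous_apply j).comp continuous_fst)
    · exact continuous_trSq.comp (continuous_const.mul (continuous_prod_inputs l))
  · have hp : 0 ≤ ∏ j, f j (ω.1 j) := Finset.prod_nonneg fun j _ => hf0 j _
    rw [Real.norm_of_nonneg (mul_nonneg hp (trSq_nonneg _))]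
    refine (mul_le_mul_of_nonneg_left (trSq_mul_prod_inputs_le h ω l B) hp).trans_eq ?_
    rw [prod_map_trSq_eq hl, mul_left_comm, ← Finset.prod_mul_distrib, mul_comm]
    congr 1
    refine Finset.prod_congr rfl fun j _ => ?_
    by_cases hj : j ∈ l
    · simp [hj, hf1 j hj]
    · simp [hj]

/-- Multiplying by a product of distinct inputs does not increase the second moment. The weights
collect the factors produced by decoupling the unitary matrices one after the other. -/
lemma integral_weight_mul_trSq_le [NeZero p] (hμ : IsNormalizedLaw μ) (h : n ≤ p) {l : List (Fin m)}
    (hl : l.Nodup) (f : Fin m → Mat n → ℝ) (hf0 : ∀ j x, 0 ≤ f j x) (hfc : ∀ j, Continuous (f j))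
    (hfi : ∀ j, Integrable (f j) μ) (hf1 : ∀ j ∈ l, f j = 1) (B : Mat p) :
    ∫ ω, (∏ j, f j (ω.1 j)) * trSq (B * (l.map (inputs ω)).prod) ∂(jointLaw m p μ) ≤
      (∏ j, ∫ x, f j x ∂μ) * trSq B := by
  induction l generalizing f B with
  | nil =>
    simp only [List.map_nil, List.prod_nil, Matrix.mul_one]
    rw [integral_mul_const, integral_prod_coord]
  | cons i l ih =>
    have hil : i ∉ l := (List.nodup_cons.1 hl).1
    have hint := integrable_weight_mul_trSq hμ h hl f hf0 hfc hfi hf1 B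
    have hfact : ∀ ω : (Fin m → Mat n) × (Fin m → Matrix.unitaryGroup (Fin p) ℂ),
        B * ((i :: l).map (inputs ω)).prod =
          B * embed p (ω.1 i) * (ω.2 i : Mat p) * (l.map (inputs ω)).prod := fun ω => by
      simp only [List.map_cons, List.prod_cons, inputs, Matrix.mul_assoc]
    simp only [hfact] at hint ⊢
    have h1 := mul_integral_trSq_mul_unitary_mul i (fun x => ∏ j, f j (x j))
      (fun x => B * embed p (x i)) (fun ω => (l.map (inputs ω)).prod)
      (fun ω U => prod_inputs_mulSingle_mul hil ω U) hint
    -- Decoupling `H_i` turns the `i`-th input into the weight `Tr |B ι(G_i)|²` and replaces `B`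
    -- by `1`; the factor `Tr 1 = p` of the remaining product cancels the factor `p` on the left.
    let f' : Fin m → Mat n → ℝ := Function.update f i fun x => trSq (B * embed p x)
    have hf'ne : ∀ j, j ≠ i → f' j = f j := fun j hj => Function.update_of_ne hj _ _
    have hf'i : f' i = fun x => trSq (B * embed p x) := Function.update_self _ _ _
    have hprod : ∀ (g g' : Fin m → ℝ), g i = 1 → (∀ j, j ≠ i → g' j = g j) →
        ∏ j, g' j = g' i * ∏ j, g j := by
      intro g g' hg hgg
      rw [← Finset.mul_prod_erase _ g (Finset.mem_univ i),
        ← Finset.mul_prod_erase _ g' (Finset.mem_univ i), hg, one_mul]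
      congr 1
      exact Finset.prod_congr rfl fun j hj => hgg j (Finset.ne_of_mem_erase hj)
    have hfi1 : f i = 1 := hf1 i (by simp)
    have h2 : ∀ ω : (Fin m → Mat n) × (Fin m → Matrix.unitaryGroup (Fin p) ℂ),
        (∏ j, f j (ω.1 j)) * (trSq (B * embed p (ω.1 i)) * trSq (l.map (inputs ω)).prod) =
        (∏ j, f' j (ω.1 j)) * trSq (1 * (l.map (inputs ω)).prod) := by
      intro ω
      rw [hprod (fun j => f j (ω.1 j)) (fun j => f' j (ω.1 j)) (by simp [hfi1])
        (fun j hj => by rw [hf'ne j hj]), hf'i, Matrix.one_mul]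
      ring
    simp only [h2] at h1
    have hIH := ih (List.nodup_cons.1 hl).2 f' ?_ ?_ ?_ ?_ 1
    · rw [← h1] at hIH
      have h3 : ∏ j, ∫ x, f' j x ∂μ =
          trSq (B * embed p (1 : Mat n)) * ∏ j, ∫ x, f j x ∂μ := by
        rw [hprod (fun j => ∫ x, f j x ∂μ) (fun j => ∫ x, f' j x ∂μ) (by simp [hfi1])
          (fun j hj => by rw [hf'ne j hj]), hf'i, hμ.integral_trSq_mul h]
      rw [h3, trSq_one, mul_comm] at hIH
      have hp : (0 : ℝ) < p := by exact_mod_cast Nat.pos_of_ne_zero (NeZero.ne p)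
      have h4 := le_of_mul_le_mul_right hIH hp
      refine h4.trans ?_
      rw [mul_comm]
      exact mul_le_mul_of_nonneg_left (trSq_mul_embed_one_le B)
        (Finset.prod_nonneg fun j _ => integral_nonneg (hf0 j))
    · intro j x
      by_cases hj : j = i
      · subst hj; rw [hf'i]; exact trSq_nonneg _
      · rw [hf'ne j hj]; exact hf0 j x
    · intro j
      by_cases hj : j = i
      · subst hj; rw [hf'i]; simp only [embed_eq]
        exact continuous_trSq.comp (by fun_prop)
      · rw [hf'ne j hj]; exact hfc j
    · intro j
      by_cases hj : j = i
      · subst hj; rw [hf'i]; exact hμ.integrable_trSq_mul h B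
      · rw [hf'ne j hj]; exact hfi j
    · intro j hj
      rw [hf'ne j fun e => hil (e ▸ hj)]
      exact hf1 j (List.mem_cons_of_mem _ hj)

end Moments

/-! ### The terms of an embedded polynomial -/

section Terms

variable {m n p : ℕ}

/-- The term `ι(Q̂(S)) ∏_{i ∈ S} ι(G_i) H_i` of the polynomial `Q^ι` at the random inputs. -/
def polyTerm (p : ℕ) (A : NCPoly m n) (S : Finset (Fin m))
    (ω : (Fin m → Mat n) × (Fin m → Matrix.unitaryGroup (Fin p) ℂ)) : Mat p :=
  embed p (A S) * monomial S (inputs ω)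

lemma eval_embed_inputs (A : NCPoly m n)
    (ω : (Fin m → Mat n) × (Fin m → Matrix.unitaryGroup (Fin p) ℂ)) :
    (A.embed p).eval (inputs ω) = ∑ S, polyTerm p A S ω := rfl

lemma continuous_term (A : NCPoly m n) (S : Finset (Fin m)) : Continuous (polyTerm p A S) :=
  continuous_const.mul (continuous_prod_inputs _)

lemma continuous_eval_inputs (A : NCPoly m n) :
    Continuous fun ω : (Fin m → Mat n) × (Fin m → Matrix.unitaryGroup (Fin p) ℂ) =>
      (A.embed p).eval (inputs ω) := by
  simp only [eval_embed_inputs]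
  exact continuous_finsetSum _ fun S _ => continuous_term A S

lemma term_empty (A : NCPoly m n)
    (ω : (Fin m → Mat n) × (Fin m → Matrix.unitaryGroup (Fin p) ℂ)) :
    polyTerm p A ∅ ω = embed p (A ∅) := by
  simp [polyTerm, monomial]

lemma term_singleton (A : NCPoly m n) (i : Fin m)
    (ω : (Fin m → Mat n) × (Fin m → Matrix.unitaryGroup (Fin p) ℂ)) :
    polyTerm p A {i} ω = embed p (A {i}) * embed p (ω.1 i) * (ω.2 i : Mat p) := by
  simp [polyTerm, monomial, inputs, Matrix.mul_assoc]

lemma trSq_term_le (h : n ≤ p) (A : NCPoly m n) (S : Finset (Fin m))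
    (ω : (Fin m → Mat n) × (Fin m → Matrix.unitaryGroup (Fin p) ℂ)) :
    trSq (polyTerm p A S ω) ≤ trSq (A S) * ∏ j, if j ∈ S then trSq (ω.1 j) else 1 := by
  have h1 := trSq_mul_prod_inputs_le h ω (S.sort (· ≤ ·)) (embed p (A S))
  rw [prod_map_trSq_eq (Finset.sort_nodup S _), trSq_embed h] at h1
  simp only [Finset.mem_sort] at h1
  exact h1

/-- Changing the signs of the unitary matrices multiplies the term of index `S` by `W_S`. -/
lemma term_signs_mul (A : NCPoly m n) (S : Finset (Fin m))
    (ω : (Fin m → Mat n) × (Fin m → Matrix.unitaryGroup (Fin p) ℂ)) (σ : Fin m → ℤˣ)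
    (U : Fin m → Matrix.unitaryGroup (Fin p) ℂ)
    (hU : ∀ i, (U i : Mat p) = ((σ i : ℤ) : ℂ) • (1 : Mat p)) :
    polyTerm p A S (ω.1, U * ω.2) = walsh S σ • polyTerm p A S ω := by
  have h1 : ∀ l : List (Fin m), (l.map (inputs (ω.1, U * ω.2))).prod =
      (l.map fun i => ((σ i : ℤ) : ℂ)).prod • (l.map (inputs ω)).prod := by
    intro l
    induction l with
    | nil => simp
    | cons i l ih =>
      have h2 : inputs (ω.1, U * ω.2) i = ((σ i : ℤ) : ℂ) • inputs ω i := by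
        simp [inputs, hU]
      simp only [List.map_cons, List.prod_cons, ih, h2]
      rw [smul_mul_smul_comm]
  have h2 : walsh S σ = ((S.sort (· ≤ ·)).map fun i => ((σ i : ℤ) : ℂ)).prod := by
    rw [← List.prod_toFinset _ (Finset.sort_nodup S _), Finset.sort_toFinset, walsh]
  rw [polyTerm, polyTerm, monomial, h1, ← h2, Matrix.mul_smul, monomial]

/-- The scalar matrices `σ_i I` as elements of the unitary group. -/
def signUnitary (p : ℕ) (σ : Fin m → ℤˣ) (i : Fin m) : Matrix.unitaryGroup (Fin p) ℂ :=
  ⟨((σ i : ℤ) : ℂ) • (1 : Mat p), by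
    rw [Matrix.mem_unitaryGroup_iff]
    rcases Int.units_eq_one_or (σ i) with h | h <;> simp [h]⟩

variable {μ : Measure (Mat n)} [IsProbabilityMeasure μ]

lemma integrable_prod_trSq (hμ : IsNormalizedLaw μ) (S : Finset (Fin m)) :
    Integrable (fun ω => ∏ j, if j ∈ S then trSq (ω.1 j) else 1) (jointLaw m p μ) := by
  have h1 := integrable_prod_coord (p := p) (μ := μ)
    (g := fun j => if j ∈ S then trSq else fun _ => 1) fun j => by
      split_ifs
      exacts [hμ.integrable_trSq, integrable_const _]
  refine h1.congr (Filter.Eventually.of_forall fun ω => ?_)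
  refine Finset.prod_congr rfl fun j _ => ?_
  split_ifs <;> rfl

lemma integral_prod_trSq (hμ : IsNormalizedLaw μ) (S : Finset (Fin m)) :
    ∫ ω, (∏ j, if j ∈ S then trSq (ω.1 j) else 1) ∂(jointLaw m p μ) = (n : ℝ) ^ S.card := by
  have h1 := integral_prod_coord (m := m) (p := p) (μ := μ)
    (fun j => if j ∈ S then trSq else fun _ => 1)
  have h2 : ∀ j, ∫ x, (if j ∈ S then trSq else fun _ => 1) x ∂μ = if j ∈ S then (n : ℝ) else 1 := by
    intro j
    split_ifs
    · exact hμ.integral_trSq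
    · simp
  have h3 : ∀ ω : (Fin m → Mat n) × (Fin m → Matrix.unitaryGroup (Fin p) ℂ),
      (∏ j, (if j ∈ S then trSq else fun _ => 1) (ω.1 j)) =
        ∏ j, if j ∈ S then trSq (ω.1 j) else 1 := fun ω =>
    Finset.prod_congr rfl fun j _ => by split_ifs <;> rfl
  simp only [h2, h3] at h1
  rw [h1, Finset.prod_ite_mem, Finset.univ_inter, Finset.prod_const]

lemma integrable_trSq_term (hμ : IsNormalizedLaw μ) (h : n ≤ p) (A : NCPoly m n)
    (S : Finset (Fin m)) : Integrable (fun ω => trSq (polyTerm p A S ω)) (jointLaw m p μ) := by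
  refine ((integrable_prod_trSq hμ S).const_mul (trSq (A S))).mono'
    (continuous_trSq.comp (continuous_term A S)).aestronglyMeasurable
    (Filter.Eventually.of_forall fun ω => ?_)
  rw [Real.norm_of_nonneg (trSq_nonneg _)]
  exact trSq_term_le h A S ω

lemma integral_trSq_term_le (hμ : IsNormalizedLaw μ) (hn : 0 < n) (h : n ≤ p) (A : NCPoly m n)
    (S : Finset (Fin m)) : ∫ ω, trSq (polyTerm p A S ω) ∂(jointLaw m p μ) ≤ trSq (A S) := by
  have : NeZero p := ⟨by omega⟩
  have h1 := integral_weight_mul_trSq_le hμ h (Finset.sort_nodup S (· ≤ ·)) (fun _ _ => 1)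
    (fun _ _ => zero_le_one) (fun _ => continuous_const) (fun _ => integrable_const _)
    (fun _ _ => rfl) (embed p (A S))
  refine le_of_eq_of_le ?_ (h1.trans_eq ?_) <;> simp [polyTerm, monomial, trSq_embed h]

lemma integrable_trSq_eval (hμ : IsNormalizedLaw μ) (h : n ≤ p) (A : NCPoly m n) :
    Integrable (fun ω => trSq ((A.embed p).eval (inputs ω))) (jointLaw m p μ) := by
  refine ((integrable_finsetSum Finset.univ fun S _ => integrable_trSq_term hμ h A S).const_mul
    ((Finset.univ : Finset (Finset (Fin m))).card : ℝ)).mono'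
    (continuous_trSq.comp (continuous_eval_inputs A)).aestronglyMeasurable
    (Filter.Eventually.of_forall fun ω => ?_)
  rw [Real.norm_of_nonneg (trSq_nonneg _), eval_embed_inputs]
  exact trSq_sum_le _ _

/-- The terms of a polynomial are orthogonal, hence the second moment of its value at the random
inputs is at most the sum of the squared Frobenius norms of the coefficients. -/
lemma integral_trSq_eval_le (hμ : IsNormalizedLaw μ) (hn : 0 < n) (h : n ≤ p) (A : NCPoly m n) :
    ∫ ω, trSq ((A.embed p).eval (inputs ω)) ∂(jointLaw m p μ) ≤ ∑ S, trSq (A S) := by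
  have h1 := card_mul_integral_eq (fun σ : Fin m → ℤˣ => signUnitary p σ)
    (integrable_trSq_eval hμ h A)
  have h2 : ∀ ω : (Fin m → Mat n) × (Fin m → Matrix.unitaryGroup (Fin p) ℂ),
      ∑ σ : Fin m → ℤˣ, trSq ((A.embed p).eval (inputs (ω.1, signUnitary p σ * ω.2))) =
        2 ^ m * ∑ S, trSq (polyTerm p A S ω) := by
    intro ω
    rw [← sum_trSq_walsh]
    refine Finset.sum_congr rfl fun σ _ => ?_
    rw [eval_embed_inputs]
    congr 1
    exact Finset.sum_congr rfl fun S _ => term_signs_mul A S ω σ _ fun i => rfl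
  simp only [h2] at h1
  have h3 : (Fintype.card (Fin m → ℤˣ) : ℝ) = 2 ^ m := by simp
  rw [integral_const_mul, h3] at h1
  rw [mul_left_cancel₀ (by positivity) h1,
    integral_finsetSum _ fun S _ => integrable_trSq_term hμ h A S]
  exact Finset.sum_le_sum fun S _ => integral_trSq_term_le hμ hn h A S

/-- A term of degree at least two is small: a Haar unitary matrix separates two corner matrices. -/
lemma mul_integral_trSq_term_le (hμ : IsNormalizedLaw μ) (hn : 0 < n) (h : n ≤ p) (A : NCPoly m n)
    {S : Finset (Fin m)} (hS : 2 ≤ S.card) :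
    p * ∫ ω, trSq (polyTerm p A S ω) ∂(jointLaw m p μ) ≤ trSq (A S) * (n : ℝ) ^ S.card := by
  have : NeZero p := ⟨by omega⟩
  obtain ⟨i, j, l, hl⟩ : ∃ i j l, S.sort (· ≤ ·) = i :: j :: l := by
    have h1 : 2 ≤ (S.sort (· ≤ ·)).length := by rwa [Finset.length_sort]
    match S.sort (· ≤ ·), h1 with
    | i :: j :: l, _ => exact ⟨i, j, l, rfl⟩
  have hnd : (i :: j :: l).Nodup := hl ▸ Finset.sort_nodup S (· ≤ ·)
  have hil : i ∉ j :: l := (List.nodup_cons.1 hnd).1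
  have hfact : ∀ ω : (Fin m → Mat n) × (Fin m → Matrix.unitaryGroup (Fin p) ℂ),
      polyTerm p A S ω = embed p (A S) * embed p (ω.1 i) * (ω.2 i : Mat p) *
        ((j :: l).map (inputs ω)).prod := fun ω => by
    simp only [polyTerm, monomial, hl, List.map_cons, List.prod_cons, inputs, Matrix.mul_assoc]
  have h1 := mul_integral_trSq_mul_unitary_mul (μ := μ) i (fun _ => 1)
    (fun x => embed p (A S) * embed p (x i)) (fun ω => ((j :: l).map (inputs ω)).prod)
    (fun ω U => prod_inputs_mulSingle_mul hil ω U)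
    (by simpa only [← hfact, one_mul] using integrable_trSq_term hμ h A S)
  simp only [← hfact, one_mul] at h1
  have h2 : ∀ ω : (Fin m → Mat n) × (Fin m → Matrix.unitaryGroup (Fin p) ℂ),
      trSq (embed p (A S) * embed p (ω.1 i)) * trSq ((j :: l).map (inputs ω)).prod ≤
        trSq (A S) * ∏ k, if k ∈ S then trSq (ω.1 k) else 1 := by
    intro ω
    have h3 : (∏ k, if k ∈ S then trSq (ω.1 k) else 1) =
        trSq (ω.1 i) * (trSq (ω.1 j) * (l.map fun k => trSq (ω.1 k)).prod) := by
      rw [← List.prod_cons, ← List.map_cons (f := fun k => trSq (ω.1 k)), ← List.prod_cons,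
        ← List.map_cons (f := fun k => trSq (ω.1 k)), prod_map_trSq_eq hnd, ← hl]
      simp only [Finset.mem_sort]
    have h4 : trSq (embed p (A S) * embed p (ω.1 i)) ≤ trSq (A S) * trSq (ω.1 i) := by
      rw [← trSq_embed h (A S), ← trSq_embed h (ω.1 i)]; exact trSq_mul_le _ _
    have h5 : trSq ((j :: l).map (inputs ω)).prod ≤
        trSq (ω.1 j) * (l.map fun k => trSq (ω.1 k)).prod := by
      rw [List.map_cons, List.prod_cons, ← trSq_inputs h]
      exact trSq_mul_prod_inputs_le h ω l _
    rw [h3, ← mul_assoc]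
    exact mul_le_mul h4 h5 (trSq_nonneg _) (mul_nonneg (trSq_nonneg _) (trSq_nonneg _))
  rw [h1]
  refine (integral_mono_of_nonneg (Filter.Eventually.of_forall fun ω =>
    mul_nonneg (trSq_nonneg _) (trSq_nonneg _)) ((integrable_prod_trSq hμ S).const_mul _)
    (Filter.Eventually.of_forall h2)).trans_eq ?_
  rw [integral_const_mul, integral_prod_trSq hμ]

/-- The product of a term of degree one with a term not involving its variable is small. -/
lemma integral_trSq_term_mul_term (hμ : IsNormalizedLaw μ) (hn : 0 < n) (h : n ≤ p) (A : NCPoly m n)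
    {S : Finset (Fin m)} {i : Fin m} (hi : i ∉ S) :
    Integrable (fun ω => trSq (polyTerm p A {i} ω * (polyTerm p A S ω)ᴴ)) (jointLaw m p μ) ∧
    p * ∫ ω, trSq (polyTerm p A {i} ω * (polyTerm p A S ω)ᴴ) ∂(jointLaw m p μ) ≤
      trSq (A {i}) * trSq (A S) * (n : ℝ) ^ (S.card + 1) := by
  have : NeZero p := ⟨by omega⟩
  have hmass : ∀ ω : (Fin m → Mat n) × (Fin m → Matrix.unitaryGroup (Fin p) ℂ),
      (∏ k, if k ∈ insert i S then trSq (ω.1 k) else 1) =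
        trSq (ω.1 i) * ∏ k, if k ∈ S then trSq (ω.1 k) else 1 := by
    intro ω
    simp only [Finset.prod_ite_mem, Finset.univ_inter]
    rw [Finset.prod_insert hi]
  have hbound : ∀ ω : (Fin m → Mat n) × (Fin m → Matrix.unitaryGroup (Fin p) ℂ),
      trSq (embed p (A {i}) * embed p (ω.1 i)) * trSq (polyTerm p A S ω)ᴴ ≤
        trSq (A {i}) * trSq (A S) * ∏ k, if k ∈ insert i S then trSq (ω.1 k) else 1 := by
    intro ω
    have h4 : trSq (embed p (A {i}) * embed p (ω.1 i)) ≤ trSq (A {i}) * trSq (ω.1 i) := by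
      rw [← trSq_embed h (A {i}), ← trSq_embed h (ω.1 i)]; exact trSq_mul_le _ _
    rw [hmass, trSq_conjTranspose]
    refine (mul_le_mul h4 (trSq_term_le h A S ω) (trSq_nonneg _)
      (mul_nonneg (trSq_nonneg _) (trSq_nonneg _))).trans_eq (by ring)
  have hint : Integrable (fun ω => trSq (polyTerm p A {i} ω * (polyTerm p A S ω)ᴴ))
      (jointLaw m p μ) := by
    refine ((integrable_prod_trSq hμ (insert i S)).const_mul
      (trSq (A {i}) * trSq (A S))).mono' ?_ (Filter.Eventually.of_forall fun ω => ?_)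
    · exact (continuous_trSq.comp ((continuous_term A {i}).mul
        (continuous_term A S).matrix_conjTranspose)).aestronglyMeasurable
    · rw [Real.norm_of_nonneg (trSq_nonneg _)]
      refine le_trans ?_ (hbound ω)
      rw [← trSq_mul_unitary (embed p (A {i}) * embed p (ω.1 i)) _ (ω.2 i).2, ← term_singleton]
      exact trSq_mul_le _ _
  refine ⟨hint, ?_⟩
  have hN : ∀ (ω : (Fin m → Mat n) × (Fin m → Matrix.unitaryGroup (Fin p) ℂ)) U,
      (polyTerm p A S (ω.1, Pi.mulSingle i U * ω.2))ᴴ = (polyTerm p A S ω)ᴴ := fun ω U => by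
    rw [polyTerm, polyTerm, monomial, prod_inputs_mulSingle_mul (by simpa using hi), monomial]
  have h1 := mul_integral_trSq_mul_unitary_mul (μ := μ) i (fun _ => 1)
    (fun x => embed p (A {i}) * embed p (x i)) (fun ω => (polyTerm p A S ω)ᴴ) hN
    (by simpa only [← term_singleton, one_mul] using hint)
  simp only [← term_singleton, one_mul] at h1
  rw [h1]
  refine (integral_mono_of_nonneg (Filter.Eventually.of_forall fun ω =>
    mul_nonneg (trSq_nonneg _) (trSq_nonneg _)) ((integrable_prod_trSq hμ (insert i S)).const_mul _)
    (Filter.Eventually.of_forall hbound)).trans_eq ?_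
  rw [integral_const_mul, integral_prod_trSq hμ, Finset.card_insert_of_notMem hi]

end Terms

/-! ### The off-diagonal part of `T Tᴴ` -/

section OffDiagonal

variable {m n p : ℕ}

/-- For a matrix supported on the `n × n` corner, the `ℓ₁` norm of the entries is at most `n` times
the Frobenius norm, whatever the size `p`. -/
lemma sq_sum_norm_le_of_support {E : Mat p}
    (hE : ∀ a b : Fin p, ¬ ((a : ℕ) < n ∧ (b : ℕ) < n) → E a b = 0) :
    (∑ a, ∑ b, ‖E a b‖) ^ 2 ≤ (n : ℝ) ^ 2 * trSq E := by
  set I : Finset (Fin p) := Finset.univ.filter fun a => (a : ℕ) < n with hI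
  have hcard : I.card ≤ n := by
    calc I.card = (I.map Fin.valEmbedding).card := (Finset.card_map _).symm
      _ ≤ (Finset.range n).card := Finset.card_le_card fun k hk => by
          simp only [hI, Finset.mem_map, Finset.mem_filter] at hk
          obtain ⟨a, ha, rfl⟩ := hk
          simpa using ha.2
      _ = n := Finset.card_range n
  have h1 : ∑ a, ∑ b, ‖E a b‖ = ∑ q ∈ I ×ˢ I, ‖E q.1 q.2‖ := by
    rw [← Fintype.sum_prod_type' (f := fun a b => ‖E a b‖)]
    refine (Finset.sum_subset (Finset.subset_univ _) fun q _ hq => ?_).symm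
    rw [hE _ _ (by simpa [hI] using hq), norm_zero]
  have h2 : ∑ q ∈ I ×ˢ I, ‖E q.1 q.2‖ ^ 2 ≤ trSq E := by
    rw [trSq_eq_sum, ← Fintype.sum_prod_type' (f := fun a b => ‖E a b‖ ^ 2)]
    exact Finset.sum_le_sum_of_subset_of_nonneg (Finset.subset_univ _) fun _ _ _ => by positivity
  rw [h1]
  refine sq_sum_le_card_mul_sum_sq.trans (mul_le_mul ?_ h2 (by positivity) (by positivity))
  rw [Finset.card_product, sq]
  exact_mod_cast Nat.mul_le_mul hcard hcard

lemma sum_norm_mul_conjTranspose_comm (X Y : Mat p) :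
    ∑ a, ∑ b, ‖(X * Yᴴ) a b‖ = ∑ a, ∑ b, ‖(Y * Xᴴ) a b‖ := by
  rw [Finset.sum_comm]
  refine Finset.sum_congr rfl fun a _ => Finset.sum_congr rfl fun b _ => ?_
  have : Y * Xᴴ = (X * Yᴴ)ᴴ := by simp
  rw [this, Matrix.conjTranspose_apply, norm_star]

lemma term_apply_eq_zero (A : NCPoly m n) (S : Finset (Fin m))
    (ω : (Fin m → Mat n) × (Fin m → Matrix.unitaryGroup (Fin p) ℂ)) {a : Fin p} (ha : ¬ (a : ℕ) < n)
    (b : Fin p) : polyTerm p A S ω a b = 0 := by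
  simp [polyTerm, Matrix.mul_apply, embed, ha]

lemma sq_sum_norm_term_mul_term_le (A : NCPoly m n) (S S' : Finset (Fin m))
    (ω : (Fin m → Mat n) × (Fin m → Matrix.unitaryGroup (Fin p) ℂ)) :
    (∑ a, ∑ b, ‖(polyTerm p A S ω * (polyTerm p A S' ω)ᴴ) a b‖) ^ 2 ≤
      (n : ℝ) ^ 2 * trSq (polyTerm p A S ω * (polyTerm p A S' ω)ᴴ) := by
  refine sq_sum_norm_le_of_support fun a b hab => ?_
  rw [Matrix.mul_apply]
  refine Finset.sum_eq_zero fun c _ => ?_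
  rw [not_and_or] at hab
  rcases hab with h | h
  · rw [term_apply_eq_zero A S ω h, zero_mul]
  · rw [Matrix.conjTranspose_apply, term_apply_eq_zero A S' ω h, star_zero, mul_zero]

/-- The arithmetic-geometric mean inequality with weight `r`, to be used with `r = √p`: a factor `a`
of mean `O(1 / p)` and a factor `b` of mean `O(1)` give a bound of mean `O(p^{-1/2})`. -/
lemma le_of_sq_le_mul {x N a b r : ℝ} (hN : 0 ≤ N) (ha : 0 ≤ a) (hb : 0 ≤ b) (hr : 0 < r)
    (h : x ^ 2 ≤ N ^ 2 * (a * b)) : x ≤ N / 2 * (r * a + b / r) := by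
  refine (le_abs_self x).trans (abs_le_of_sq_le_sq (h.trans ?_) (by positivity))
  have h1 : (r * a + b / r) ^ 2 = 4 * (a * b) + (r * a - b / r) ^ 2 := by field_simp; ring
  rw [mul_pow, h1]
  nlinarith [mul_nonneg (sq_nonneg N) (sq_nonneg (r * a - b / r))]

variable {μ : Measure (Mat n)} [IsProbabilityMeasure μ]

/-- One half of the cases of `exists_integrable_bound`; the other half follows by exchanging `S` and
`S'`. -/
lemma exists_integrable_bound_aux (hμ : IsNormalizedLaw μ) (hn : 0 < n) (h : n ≤ p) (A : NCPoly m n)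
    (hA : ∀ S, trSq (A S) ≤ n) (S S' : Finset (Fin m))
    (hSS : 2 ≤ S.card ∨ ∃ i, S = {i} ∧ i ∉ S' ∧ S'.card ≤ 1) :
    ∃ R : (Fin m → Mat n) × (Fin m → Matrix.unitaryGroup (Fin p) ℂ) → ℝ,
      Integrable R (jointLaw m p μ) ∧
      (∀ ω, ∑ a, ∑ b, ‖(polyTerm p A S ω * (polyTerm p A S' ω)ᴴ) a b‖ ≤ R ω) ∧
      ∫ ω, R ω ∂(jointLaw m p μ) ≤ (n : ℝ) ^ (m + 5) / √p := by
  have hn1 : (1 : ℝ) ≤ n := by exact_mod_cast hn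
  have hp : (0 : ℝ) < p := by exact_mod_cast (by omega : 0 < p)
  have hr : 0 < √(p : ℝ) := Real.sqrt_pos.2 hp
  have hpow : ∀ {k l : ℕ}, k ≤ l → (n : ℝ) ^ k ≤ (n : ℝ) ^ l := fun hkl =>
    pow_le_pow_right₀ hn1 hkl
  have hrp : ∀ x : ℝ, √(p : ℝ) * x = p * x / √p := fun x => by
    rw [eq_div_iff hr.ne', mul_right_comm, Real.mul_self_sqrt hp.le]
  rcases hSS with hS | ⟨i, rfl, hi, hS'⟩
  -- Here one factor is small by itself. Bounding the second moment of the product would require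
  -- fourth moments of `G`, so the two factors are separated first.
  · have hi1 := integrable_trSq_term (p := p) hμ h A S
    have hi2 := integrable_trSq_term (p := p) hμ h A S'
    refine ⟨fun ω => n / 2 * (√p * trSq (polyTerm p A S ω) + trSq (polyTerm p A S' ω) / √p),
      ((hi1.const_mul _).add (hi2.div_const _)).const_mul _, fun ω => ?_, ?_⟩
    · refine le_of_sq_le_mul (by positivity) (trSq_nonneg _) (trSq_nonneg _) hr
        ((sq_sum_norm_term_mul_term_le A S S' ω).trans ?_)
      refine mul_le_mul_of_nonneg_left ((trSq_mul_le _ _).trans_eq ?_) (by positivity)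
      rw [trSq_conjTranspose]
    · rw [integral_const_mul, integral_add (hi1.const_mul _) (hi2.div_const _), integral_const_mul,
        integral_div]
      have h1 := mul_integral_trSq_term_le hμ hn h A hS
      have h2 := (integral_trSq_term_le hμ hn h A S').trans (hA S')
      have h3 : trSq (A S) * (n : ℝ) ^ S.card ≤ (n : ℝ) ^ (m + 1) := by
        rw [pow_succ']
        exact mul_le_mul (hA S) (hpow (by simpa using Finset.card_le_univ S)) (by positivity)
          (by positivity)
      have h4 : √(p : ℝ) * ∫ ω, trSq (polyTerm p A S ω) ∂(jointLaw m p μ) ≤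
          (n : ℝ) ^ (m + 1) / √p := by
        rw [hrp]
        exact div_le_div_of_nonneg_right (h1.trans h3) hr.le
      have h5 : (∫ ω, trSq (polyTerm p A S' ω) ∂(jointLaw m p μ)) / √p ≤ (n : ℝ) ^ (m + 1) / √p :=
        div_le_div_of_nonneg_right (h2.trans (by simpa using hpow (show 1 ≤ m + 1 by omega))) hr.le
      calc _ ≤ (n : ℝ) / 2 * ((n : ℝ) ^ (m + 1) / √p + (n : ℝ) ^ (m + 1) / √p) :=
            mul_le_mul_of_nonneg_left (add_le_add h4 h5) (by positivity)
        _ = (n : ℝ) ^ (m + 2) / √p := by ring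
        _ ≤ _ := div_le_div_of_nonneg_right (hpow (by omega)) hr.le
  · obtain ⟨hi1, h1⟩ := integral_trSq_term_mul_term (p := p) hμ hn h A hi
    refine ⟨fun ω => n / 2 * (√p * trSq (polyTerm p A {i} ω * (polyTerm p A S' ω)ᴴ) + 1 / √p),
      ((hi1.const_mul _).add (integrable_const _)).const_mul _, fun ω => ?_, ?_⟩
    · exact le_of_sq_le_mul (by positivity) (trSq_nonneg _) zero_le_one hr
        ((sq_sum_norm_term_mul_term_le A {i} S' ω).trans_eq (by rw [mul_one]))
    · rw [integral_const_mul, integral_add (hi1.const_mul _) (integrable_const _),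
        integral_const_mul, integral_const]
      have h3 : trSq (A {i}) * trSq (A S') * (n : ℝ) ^ (S'.card + 1) ≤ (n : ℝ) ^ 4 := by
        calc _ ≤ (n : ℝ) * n * (n : ℝ) ^ 2 :=
              mul_le_mul (mul_le_mul (hA _) (hA _) (trSq_nonneg _) (by positivity))
                (hpow (by omega)) (by positivity) (by positivity)
          _ = _ := by ring
      have h4 : √(p : ℝ) * ∫ ω, trSq (polyTerm p A {i} ω * (polyTerm p A S' ω)ᴴ) ∂(jointLaw m p μ) ≤
          (n : ℝ) ^ 4 / √p := by
        rw [hrp]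
        exact div_le_div_of_nonneg_right (h1.trans h3) hr.le
      have h5 : (1 : ℝ) / √p ≤ (n : ℝ) ^ 4 / √p :=
        div_le_div_of_nonneg_right (by simpa using hpow (show 0 ≤ 4 by omega)) hr.le
      calc _ ≤ (n : ℝ) / 2 * ((n : ℝ) ^ 4 / √p + (n : ℝ) ^ 4 / √p) := by
            refine mul_le_mul_of_nonneg_left (add_le_add h4 ?_) (by positivity)
            simpa using h5
        _ = (n : ℝ) ^ 5 / √p := by ring
        _ ≤ _ := div_le_div_of_nonneg_right (hpow (by omega)) hr.le

/-- All products of two terms are of size `O(p^{-1/2})` in mean, except the squares of the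
terms of degree at most one. -/
lemma exists_integrable_bound (hμ : IsNormalizedLaw μ) (hn : 0 < n) (h : n ≤ p) (A : NCPoly m n)
    (hA : ∀ S, trSq (A S) ≤ n) (S S' : Finset (Fin m)) (hSS : ¬ (S = S' ∧ S.card ≤ 1)) :
    ∃ R : (Fin m → Mat n) × (Fin m → Matrix.unitaryGroup (Fin p) ℂ) → ℝ,
      Integrable R (jointLaw m p μ) ∧
      (∀ ω, ∑ a, ∑ b, ‖(polyTerm p A S ω * (polyTerm p A S' ω)ᴴ) a b‖ ≤ R ω) ∧
      ∫ ω, R ω ∂(jointLaw m p μ) ≤ (n : ℝ) ^ (m + 5) / √p := by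
  have key : (2 ≤ S.card ∨ ∃ i, S = {i} ∧ i ∉ S' ∧ S'.card ≤ 1) ∨
      (2 ≤ S'.card ∨ ∃ i, S' = {i} ∧ i ∉ S ∧ S.card ≤ 1) := by
    by_cases h1 : 2 ≤ S.card
    · exact Or.inl (Or.inl h1)
    by_cases h2 : 2 ≤ S'.card
    · exact Or.inr (Or.inl h2)
    have h1' : S.card ≤ 1 := by omega
    have h2' : S'.card ≤ 1 := by omega
    have hne : S ≠ S' := fun e => hSS ⟨e, h1'⟩
    rcases Nat.le_one_iff_eq_zero_or_eq_one.1 h1' with h0 | h0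
    · rw [Finset.card_eq_zero] at h0
      subst h0
      have h3 : S'.card = 1 :=
        le_antisymm h2' (Finset.card_pos.2 (Finset.nonempty_iff_ne_empty.2 hne.symm))
      obtain ⟨i, rfl⟩ := Finset.card_eq_one.1 h3
      exact Or.inr (Or.inr ⟨i, rfl, by simp, by simp⟩)
    · obtain ⟨i, rfl⟩ := Finset.card_eq_one.1 h0
      refine Or.inl (Or.inr ⟨i, rfl, fun hi => hne ?_, h2'⟩)
      exact Finset.eq_of_subset_of_card_le (by simpa using hi) (by simpa using h2')
  rcases key with hk | hk
  · exact exists_integrable_bound_aux hμ hn h A hA S S' hk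
  · obtain ⟨R, hR, hb, hI⟩ := exists_integrable_bound_aux (p := p) hμ hn h A hA S' S hk
    exact ⟨R, hR, fun ω => (sum_norm_mul_conjTranspose_comm _ _).trans_le (hb ω), hI⟩

end OffDiagonal

/-! ### Concentration of the diagonal part of `T Tᴴ` -/

section Concentration

variable {m n : ℕ} {μ : Measure (Mat n)} [IsProbabilityMeasure μ]

lemma integrable_comp_eval_pi {ξ : Mat n → ℝ} (hξ : Integrable ξ μ) (i : Fin m) :
    Integrable (fun x : Fin m → Mat n => ξ (x i)) (Measure.pi fun _ => μ) :=
  (measurePreserving_eval (fun _ : Fin m => μ) i).integrable_comp_of_integrable hξ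

/-- Second moments of independent centred real random variables add up. -/
lemma integral_sq_sum_pi (ξ : Fin m → Mat n → ℝ) (hL : ∀ i, MemLp (ξ i) 2 μ)
    (h0 : ∀ i, ∫ x, ξ i x ∂μ = 0) :
    ∫ x, (∑ i, ξ i (x i)) ^ 2 ∂(Measure.pi fun _ => μ) = ∑ i, ∫ x, ξ i x ^ 2 ∂μ := by
  have hi : ∀ i, Integrable (ξ i) μ := fun i => (hL i).integrable one_le_two
  have h1 := ProbabilityTheory.variance_sum_pi hL
  have h2 : ∀ i, ∫ x : Fin m → Mat n, ξ i (x i) ∂(Measure.pi fun _ => μ) = 0 := by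
    intro i
    have h3 := measurePreserving_eval (fun _ : Fin m => μ) i
    have h4 := integral_map (f := ξ i) h3.measurable.aemeasurable
      (by rw [h3.map_eq]; exact (hi i).aestronglyMeasurable)
    rw [h3.map_eq, h0 i] at h4
    exact h4.symm
  have hs : (∑ i, fun x : Fin m → Mat n => ξ i (x i)) = fun x => ∑ i, ξ i (x i) := by
    ext x; simp
  have hsi : Integrable (fun x : Fin m → Mat n => ∑ i, ξ i (x i)) (Measure.pi fun _ => μ) :=
    integrable_finsetSum _ fun i _ => integrable_comp_eval_pi (hi i) i
  rw [hs,
    ProbabilityTheory.variance_of_integral_eq_zero hsi.aestronglyMeasurable.aemeasurable] at h1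
  · rw [h1]
    exact Finset.sum_congr rfl fun i _ =>
      ProbabilityTheory.variance_of_integral_eq_zero (hi i).aestronglyMeasurable.aemeasurable (h0 i)
  · rw [integral_finsetSum _ fun i _ => integrable_comp_eval_pi (hi i) i]
    simp [h2]

/-- The fluctuation `A (G Gᴴ - 1) Aᴴ` of `A G Gᴴ Aᴴ` around its mean. -/
def fluct (A G : Mat n) : Mat n := A * (G * Gᴴ - 1) * Aᴴ

lemma continuous_fluct (A : Mat n) : Continuous (fluct A) := by
  have h : Continuous fun G : Mat n => Gᴴ := continuous_id.matrix_conjTranspose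
  exact (continuous_const.mul ((continuous_id.mul h).sub continuous_const)).mul continuous_const

/-- The functional `X ↦ (A X Aᴴ)_{ab}`. -/
def conjEntry (A : Mat n) (a b : Fin n) : Mat n →ₗ[ℂ] ℂ where
  toFun X := (A * X * Aᴴ) a b
  map_add' X Y := by simp [Matrix.mul_add, Matrix.add_mul]
  map_smul' c X := by simp

lemma integral_fluct_apply (hμ : IsNormalizedLaw μ) (A : Mat n) (a b : Fin n) :
    Integrable (fun G => fluct A G a b) μ ∧ ∫ G, fluct A G a b ∂μ = 0 := by
  have h1 : ∀ G, fluct A G a b = conjEntry A a b (G * Gᴴ) - conjEntry A a b 1 := fun G => by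
    rw [← map_sub]; rfl
  have h2 := hμ.integrable_sq.integrable_linearMap (conjEntry A a b)
  simp only [h1]
  refine ⟨h2.sub (integrable_const _), ?_⟩
  rw [integral_sub h2 (integrable_const _), hμ.integrable_sq.integral_linearMap, hμ.cov_eq_one]
  simp

lemma trSq_mul_sub_one_eq (A G : Mat n) : trSq (A * (G * Gᴴ - 1)) =
    (traceConj A ((G * Gᴴ) ^ 2) - 2 * traceConj A (G * Gᴴ) + traceConj A (1 : Mat n)).re := by
  have h1 : (A * (G * Gᴴ - 1)) * (A * (G * Gᴴ - 1))ᴴ =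
      A * ((G * Gᴴ) ^ 2 - (2 : ℂ) • (G * Gᴴ) + 1) * Aᴴ := by
    have h2 : (G * Gᴴ - 1) * (G * Gᴴ - 1)ᴴ = (G * Gᴴ) ^ 2 - (2 : ℂ) • (G * Gᴴ) + 1 := by
      rw [Matrix.conjTranspose_sub, Matrix.conjTranspose_mul, Matrix.conjTranspose_conjTranspose,
        Matrix.conjTranspose_one, two_smul]
      noncomm_ring
    rw [← h2]; simp only [Matrix.conjTranspose_mul, Matrix.mul_assoc]
  have h3 : traceConj A ((G * Gᴴ) ^ 2 - (2 : ℂ) • (G * Gᴴ) + 1) =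
      traceConj A ((G * Gᴴ) ^ 2) - 2 * traceConj A (G * Gᴴ) + traceConj A (1 : Mat n) := by
    rw [map_add, map_sub, map_smul, smul_eq_mul]
  rw [trSq, h1, ← h3]
  simp only [traceConj, LinearMap.coe_mk, AddHom.coe_mk, embed_self]

lemma integral_trSq_mul_sub_one_le (hμ : IsNormalizedLaw μ) {c : ℝ} (hc : 0 < c)
    (h2 : IntegrableMat (fun G => (G * Gᴴ) ^ 2) μ)
    (hc2 : opNorm (expMat (fun G => (G * Gᴴ) ^ 2) μ) ≤ c) (A : Mat n) :
    Integrable (fun G => trSq (A * (G * Gᴴ - 1))) μ ∧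
      ∫ G, trSq (A * (G * Gᴴ - 1)) ∂μ ≤ c * trSq A := by
  have i1 := h2.integrable_linearMap (traceConj A)
  have i2 := (hμ.integrable_sq.integrable_linearMap (traceConj A)).const_mul (2 : ℂ)
  have i12 : Integrable (fun G => traceConj A ((G * Gᴴ) ^ 2) - 2 * traceConj A (G * Gᴴ)) μ :=
    i1.sub i2
  have i3 : Integrable (fun G => traceConj A ((G * Gᴴ) ^ 2) - 2 * traceConj A (G * Gᴴ) +
      traceConj A (1 : Mat n)) μ := i12.add (integrable_const _)
  simp only [trSq_mul_sub_one_eq]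
  refine ⟨i3.re, ?_⟩
  have h3 := integral_re i3
  rw [integral_add i12 (integrable_const _), integral_sub i1 i2, integral_const_mul,
    h2.integral_linearMap, hμ.integrable_sq.integral_linearMap, hμ.cov_eq_one] at h3
  refine (le_of_eq h3).trans ?_
  have h4 : (traceConj A (1 : Mat n)).re = trSq A := by simp [traceConj, embed_self, trSq]
  have h5 : (traceConj A (expMat (fun G => (G * Gᴴ) ^ 2) μ)).re ≤ c * trSq A := by
    simpa [traceConj, embed_self] using re_trace_conj_le A _ hc hc2
  simp
  have h6 := trSq_nonneg A
  linarith

lemma integral_trSq_fluct_le (hμ : IsNormalizedLaw μ) {c : ℝ} (hc : 0 < c)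
    (h2 : IntegrableMat (fun G => (G * Gᴴ) ^ 2) μ)
    (hc2 : opNorm (expMat (fun G => (G * Gᴴ) ^ 2) μ) ≤ c) (A : Mat n) :
    Integrable (fun G => trSq (fluct A G)) μ ∧ ∫ G, trSq (fluct A G) ∂μ ≤ c * trSq A * trSq A := by
  obtain ⟨h3, h4⟩ := integral_trSq_mul_sub_one_le hμ hc h2 hc2 A
  have h5 : ∀ G, trSq (fluct A G) ≤ trSq (A * (G * Gᴴ - 1)) * trSq A := fun G => by
    rw [← trSq_conjTranspose A]; exact trSq_mul_le _ _
  have h6 : Integrable (fun G => trSq (fluct A G)) μ := by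
    refine (h3.mul_const (trSq A)).mono'
      (continuous_trSq.comp (continuous_fluct A)).aestronglyMeasurable
      (Filter.Eventually.of_forall fun G => ?_)
    rw [Real.norm_of_nonneg (trSq_nonneg _)]
    exact h5 G
  refine ⟨h6, (integral_mono h6 (h3.mul_const _) h5).trans ?_⟩
  rw [integral_mul_const]
  exact mul_le_mul_of_nonneg_right h4 (trSq_nonneg _)

lemma trSq_eq_sum_re_im (A : Mat n) : trSq A = ∑ a, ∑ b, ((A a b).re ^ 2 + (A a b).im ^ 2) := by
  rw [trSq_eq_sum]
  refine Finset.sum_congr rfl fun a _ => Finset.sum_congr rfl fun b _ => ?_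
  rw [Complex.sq_norm, Complex.normSq_apply]; ring

/-- Second moments of independent centred random matrices add up. -/
lemma integral_trSq_sum_pi (F : Fin m → Mat n → Mat n) (hFc : ∀ i, Continuous (F i))
    (hF : ∀ i, Integrable (fun G => trSq (F i G)) μ)
    (hF1 : ∀ i a b, Integrable (fun G => F i G a b) μ)
    (hF0 : ∀ i a b, ∫ G, F i G a b ∂μ = 0) :
    Integrable (fun x : Fin m → Mat n => trSq (∑ i, F i (x i))) (Measure.pi fun _ => μ) ∧
    ∫ x : Fin m → Mat n, trSq (∑ i, F i (x i)) ∂(Measure.pi fun _ => μ) =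
      ∑ i, ∫ G, trSq (F i G) ∂μ := by
  have hint : Integrable (fun x : Fin m → Mat n => trSq (∑ i, F i (x i)))
      (Measure.pi fun _ => μ) := by
    refine ((integrable_finsetSum Finset.univ fun i _ =>
      integrable_comp_eval_pi (hF i) i).const_mul
      ((Finset.univ : Finset (Fin m)).card : ℝ)).mono' ?_ (Filter.Eventually.of_forall fun x => ?_)
    · exact (continuous_trSq.comp (continuous_finsetSum _ fun i _ =>
        (hFc i).comp (continuous_apply i))).aestronglyMeasurable
    · rw [Real.norm_of_nonneg (trSq_nonneg _)]
      exact trSq_sum_le _ _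
  refine ⟨hint, ?_⟩
  have hle : ∀ i a b G, ‖F i G a b‖ ^ 2 ≤ trSq (F i G) := fun i a b G => by
    rw [trSq_eq_sum]
    refine (Finset.single_le_sum (f := fun b => ‖F i G a b‖ ^ 2)
      (fun _ _ => by positivity) (Finset.mem_univ b)).trans ?_
    exact Finset.single_le_sum (f := fun a => ∑ b, ‖F i G a b‖ ^ 2)
      (fun _ _ => by positivity) (Finset.mem_univ a)
  have hL : ∀ (φ : ℂ → ℝ), Continuous φ → (∀ z, |φ z| ≤ ‖z‖) → ∀ i a b,
      MemLp (fun G => φ (F i G a b)) 2 μ := fun φ hφ hφ1 i a b => by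
    have hc : Continuous fun G => φ (F i G a b) := hφ.comp ((hFc i).matrix_elem a b)
    rw [memLp_two_iff_integrable_sq hc.aestronglyMeasurable]
    refine (hF i).mono' (hc.pow 2).aestronglyMeasurable (Filter.Eventually.of_forall fun G => ?_)
    rw [Real.norm_of_nonneg (sq_nonneg _), ← sq_abs]
    exact (pow_le_pow_left₀ (abs_nonneg _) (hφ1 _) 2).trans (hle i a b G)
  have hre := hL Complex.re Complex.continuous_re Complex.abs_re_le_norm
  have him := hL Complex.im Complex.continuous_im Complex.abs_im_le_norm
  have hre0 : ∀ i a b, ∫ G, (F i G a b).re ∂μ = 0 := fun i a b => by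
    have := integral_re (hF1 i a b)
    rw [hF0 i a b] at this
    simpa using this
  have him0 : ∀ i a b, ∫ G, (F i G a b).im ∂μ = 0 := fun i a b => by
    have := integral_im (hF1 i a b)
    rw [hF0 i a b] at this
    simpa using this
  have hsq : ∀ (ξ : Fin m → Mat n → ℝ), (∀ i, MemLp (ξ i) 2 μ) → Integrable
      (fun x : Fin m → Mat n => (∑ i, ξ i (x i)) ^ 2) (Measure.pi fun _ => μ) := fun ξ hξ =>
    (memLp_finsetSum Finset.univ fun i _ => (hξ i).comp_measurePreserving
      (measurePreserving_eval (fun _ : Fin m => μ) i)).integrable_sq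
  have e1 : ∀ a b, Integrable (fun x : Fin m → Mat n => (∑ i, (F i (x i) a b).re) ^ 2)
      (Measure.pi fun _ => μ) := fun a b =>
    hsq (fun i G => (F i G a b).re) fun i => hre i a b
  have e2 : ∀ a b, Integrable (fun x : Fin m → Mat n => (∑ i, (F i (x i) a b).im) ^ 2)
      (Measure.pi fun _ => μ) := fun a b =>
    hsq (fun i G => (F i G a b).im) fun i => him i a b
  have e3 : ∀ i a b, Integrable (fun G => (F i G a b).re ^ 2) μ := fun i a b =>
    (hre i a b).integrable_sq
  have e4 : ∀ i a b, Integrable (fun G => (F i G a b).im ^ 2) μ := fun i a b =>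
    (him i a b).integrable_sq
  have e12 : ∀ a b, Integrable (fun x : Fin m → Mat n => (∑ i, (F i (x i) a b).re) ^ 2 +
      (∑ i, (F i (x i) a b).im) ^ 2) (Measure.pi fun _ => μ) := fun a b => (e1 a b).add (e2 a b)
  have e34 : ∀ i a b, Integrable (fun G => (F i G a b).re ^ 2 + (F i G a b).im ^ 2) μ :=
    fun i a b => (e3 i a b).add (e4 i a b)
  have e5 : ∀ i, ∫ G, trSq (F i G) ∂μ =
      ∑ a, ∑ b, (∫ G, (F i G a b).re ^ 2 ∂μ + ∫ G, (F i G a b).im ^ 2 ∂μ) := by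
    intro i
    simp only [trSq_eq_sum_re_im]
    rw [integral_finsetSum _ fun a _ => integrable_finsetSum _ fun b _ => e34 i a b]
    refine Finset.sum_congr rfl fun a _ => ?_
    rw [integral_finsetSum _ fun b _ => e34 i a b]
    exact Finset.sum_congr rfl fun b _ => integral_add (e3 i a b) (e4 i a b)
  simp only [e5]
  simp only [trSq_eq_sum_re_im, Matrix.sum_apply, Complex.re_sum, Complex.im_sum]
  rw [integral_finsetSum _ fun a _ => integrable_finsetSum _ fun b _ => e12 a b,
    Finset.sum_comm]
  refine Finset.sum_congr rfl fun a _ => ?_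
  rw [integral_finsetSum _ fun b _ => e12 a b, Finset.sum_comm]
  refine Finset.sum_congr rfl fun b _ => ?_
  rw [integral_add (e1 a b) (e2 a b),
    integral_sq_sum_pi (fun i G => (F i G a b).re) (fun i => hre i a b) (fun i => hre0 i a b),
    integral_sq_sum_pi (fun i G => (F i G a b).im) (fun i => him i a b) (fun i => him0 i a b),
    Finset.sum_add_distrib]

/-- The fourth moment bound on `G` controls the fluctuation of the main part of `T Tᴴ`. -/
lemma integral_trSq_sum_fluct_le (hμ : IsNormalizedLaw μ) {c : ℝ} (hc : 0 < c)
    (h2 : IntegrableMat (fun G => (G * Gᴴ) ^ 2) μ)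
    (hc2 : opNorm (expMat (fun G => (G * Gᴴ) ^ 2) μ) ≤ c) (A : Fin m → Mat n) :
    Integrable (fun x : Fin m → Mat n => trSq (∑ i, fluct (A i) (x i))) (Measure.pi fun _ => μ) ∧
    ∫ x : Fin m → Mat n, trSq (∑ i, fluct (A i) (x i)) ∂(Measure.pi fun _ => μ) ≤
      c * ∑ i, trSq (A i) ^ 2 := by
  have hF := fun i => integral_trSq_fluct_le hμ hc h2 hc2 (A i)
  obtain ⟨hint, hsum⟩ := integral_trSq_sum_pi (fun i => fluct (A i)) (fun i => continuous_fluct _)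
    (fun i => (hF i).1) (fun i a b => (integral_fluct_apply hμ (A i) a b).1)
    (fun i a b => (integral_fluct_apply hμ (A i) a b).2)
  refine ⟨hint, ?_⟩
  rw [hsum, Finset.mul_sum]
  exact Finset.sum_le_sum fun i _ => (hF i).2.trans_eq (by ring)

end Concentration

/-! ### The truncation error of a polynomial -/

section Truncation

variable {m n p : ℕ}

/-- The coefficients of `A` form a row contraction: `∑_S A(S) A(S)ᴴ ≤ 1`. -/
def IsRowContraction (A : NCPoly m n) : Prop :=
  ∀ v : Fin n → ℂ, ∑ S, ∑ b, ‖(v ᵥ* A S) b‖ ^ 2 ≤ ∑ a, ‖v a‖ ^ 2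

lemma IsRowContraction.sum_trSq_le {A : NCPoly m n} (hA : IsRowContraction A) :
    ∑ S, trSq (A S) ≤ n := by
  simp only [trSq_eq_sum]
  rw [Finset.sum_comm]
  have h : ∀ a : Fin n, ∑ S, ∑ b, ‖A S a b‖ ^ 2 ≤ 1 := by
    intro a
    have h1 := hA (Pi.single a 1)
    have h2 : ∑ a', ‖(Pi.single a 1 : Fin n → ℂ) a'‖ ^ 2 = 1 := by
      rw [Finset.sum_eq_single a]
      · simp
      · intro b _ hb; simp [Pi.single_eq_of_ne hb]
      · simp
    simpa [h2, Matrix.single_one_vecMul] using h1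
  simpa using Finset.sum_le_sum fun a (_ : a ∈ Finset.univ) => h a

lemma IsRowContraction.trSq_le {A : NCPoly m n} (hA : IsRowContraction A) (S : Finset (Fin m)) :
    trSq (A S) ≤ n :=
  (Finset.single_le_sum (f := fun S => trSq (A S)) (fun _ _ => trSq_nonneg _)
    (Finset.mem_univ S)).trans hA.sum_trSq_le

lemma re_star_dotProduct_mul_conjTranspose (X : Mat p) (v : Fin p → ℂ) :
    (star v ⬝ᵥ (X * Xᴴ) *ᵥ v).re = ∑ b, ‖(star v ᵥ* X) b‖ ^ 2 := by
  have h : Xᴴ *ᵥ v = star (star v ᵥ* X) := by rw [Matrix.star_vecMul, star_star]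
  rw [← Matrix.mulVec_mulVec, Matrix.dotProduct_mulVec, h]
  simp [dotProduct, Complex.mul_conj', ← Complex.ofReal_pow]

lemma IsRowContraction.re_star_dotProduct_le {A : NCPoly m n} (hA : IsRowContraction A)
    (h : n ≤ p) (s : Finset (Finset (Fin m))) (v : Fin p → ℂ) :
    (star v ⬝ᵥ (∑ S ∈ s, embed p (A S * (A S)ᴴ)) *ᵥ v).re ≤ ∑ a, ‖v a‖ ^ 2 := by
  simp only [embed_mul h, embed_conjTranspose, Matrix.sum_mulVec, dotProduct_sum, Complex.re_sum,
    re_star_dotProduct_mul_conjTranspose, sum_norm_sq_vecMul_embed h]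
  refine (Finset.sum_le_sum_of_subset_of_nonneg (Finset.subset_univ s)
    fun _ _ _ => by positivity).trans ?_
  refine (hA _).trans ((sum_norm_sq_comp_castLE_le h _).trans_eq ?_)
  simp

lemma sum_card_le_one {M : Type*} [AddCommMonoid M] (g : Finset (Fin m) → M) :
    ∑ S with S.card ≤ 1, g S = g ∅ + ∑ i, g {i} := by
  have h : (Finset.univ.filter fun S : Finset (Fin m) => S.card ≤ 1) =
      insert ∅ (Finset.univ.image fun i => ({i} : Finset (Fin m))) := by
    ext S
    simp only [Finset.mem_filter, Finset.mem_univ, true_and, Finset.mem_insert, Finset.mem_image,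
      Nat.le_one_iff_eq_zero_or_eq_one, Finset.card_eq_zero, Finset.card_eq_one, eq_comm]
  rw [h, Finset.sum_insert (by simp), Finset.sum_image Finset.singleton_injective.injOn]

lemma term_empty_mul_conjTranspose (h : n ≤ p) (A : NCPoly m n)
    (ω : (Fin m → Mat n) × (Fin m → Matrix.unitaryGroup (Fin p) ℂ)) :
    polyTerm p A ∅ ω * (polyTerm p A ∅ ω)ᴴ = embed p (A ∅ * (A ∅)ᴴ) := by
  rw [term_empty, embed_mul h, embed_conjTranspose]

lemma term_singleton_mul_conjTranspose (h : n ≤ p) (A : NCPoly m n) (i : Fin m)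
    (ω : (Fin m → Mat n) × (Fin m → Matrix.unitaryGroup (Fin p) ℂ)) :
    polyTerm p A {i} ω * (polyTerm p A {i} ω)ᴴ =
      embed p (A {i} * (A {i})ᴴ) + embed p (fluct (A {i}) (ω.1 i)) := by
  have hU : (ω.2 i : Mat p) * (ω.2 i : Mat p)ᴴ = 1 := Matrix.mem_unitaryGroup_iff.1 (ω.2 i).2
  rw [term_singleton, ← embed_add, ← embed_mul h, Matrix.conjTranspose_mul,
    Matrix.mul_assoc, ← Matrix.mul_assoc (ω.2 i : Mat p), hU, Matrix.one_mul,
    ← embed_conjTranspose, ← embed_mul h]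
  congr 1
  simp only [fluct, Matrix.conjTranspose_mul, Matrix.mul_sub, Matrix.sub_mul, Matrix.mul_one,
    Matrix.mul_assoc]
  abel

/-- The pairs of indices whose contribution to `T Tᴴ` vanishes as `p → ∞`. -/
def smallPairs (m : ℕ) : Finset (Finset (Fin m) × Finset (Fin m)) :=
  Finset.univ.filter fun q => ¬ (q.1 = q.2 ∧ q.1.card ≤ 1)

/-- The decomposition of `T Tᴴ` into the mean of its main part, the fluctuation of its main part,
and the products that vanish as `p → ∞`. -/
lemma eval_mul_conjTranspose (h : n ≤ p) (A : NCPoly m n)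
    (ω : (Fin m → Mat n) × (Fin m → Matrix.unitaryGroup (Fin p) ℂ)) :
    (A.embed p).eval (inputs ω) * ((A.embed p).eval (inputs ω))ᴴ =
      ∑ S with S.card ≤ 1, embed p (A S * (A S)ᴴ) +
        embed p (∑ i, fluct (A {i}) (ω.1 i)) +
        ∑ q ∈ smallPairs m, polyTerm p A q.1 ω * (polyTerm p A q.2 ω)ᴴ := by
  have h1 : ∑ q with (q : Finset (Fin m) × Finset (Fin m)).1 = q.2 ∧ q.1.card ≤ 1,
      polyTerm p A q.1 ω * (polyTerm p A q.2 ω)ᴴ =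
      ∑ S with S.card ≤ 1, polyTerm p A S ω * (polyTerm p A S ω)ᴴ := by
    symm
    refine Finset.sum_bij (fun S _ => (S, S)) ?_ ?_ ?_ ?_
    · intro S hS; simpa using hS
    · intro S _ S' _ hSS; exact congrArg Prod.fst hSS
    · rintro ⟨S, S'⟩ hq
      simp only [Finset.mem_filter, Finset.mem_univ, true_and] at hq
      exact ⟨S, by simpa using hq.2, by rw [← hq.1]⟩
    · intro S _; rfl
  rw [eval_embed_inputs, Matrix.conjTranspose_sum, Finset.sum_mul_sum,
    ← Fintype.sum_prod_type' (f := fun S S' => polyTerm p A S ω * (polyTerm p A S' ω)ᴴ),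
    ← Finset.sum_filter_add_sum_filter_not Finset.univ
      (fun q : Finset (Fin m) × Finset (Fin m) => q.1 = q.2 ∧ q.1.card ≤ 1), h1]
  congr 1
  rw [sum_card_le_one, sum_card_le_one, term_empty_mul_conjTranspose h]
  simp only [term_singleton_mul_conjTranspose h]
  rw [Finset.sum_add_distrib, embed_sum, add_assoc]

variable {μ : Measure (Mat n)} [IsProbabilityMeasure μ]

lemma integrable_trSq_sub_chop (hμ : IsNormalizedLaw μ) (h : n ≤ p) (A : NCPoly m n) :
    Integrable (fun ω => trSq ((A.embed p).eval (inputs ω) - chop ((A.embed p).eval (inputs ω))))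
      (jointLaw m p μ) := by
  have hc := continuous_eval_inputs (p := p) A
  refine (integrable_trSq_eval hμ h A).mono'
    (continuous_trSq.comp (hc.sub (continuous_chop.comp hc))).aestronglyMeasurable
    (Filter.Eventually.of_forall fun ω => ?_)
  rw [Real.norm_of_nonneg (trSq_nonneg _)]
  exact trSq_sub_chop_le _

/-- The mean truncation error of a row contraction is controlled by the fluctuations of its linear
part, up to an error of order `p^{-1/2}`. -/
lemma integral_trSq_sub_chop_le (hμ : IsNormalizedLaw μ) (hn : 0 < n) (h : n ≤ p) {c : ℝ}
    (hc : 0 < c) (h2 : IntegrableMat (fun G => (G * Gᴴ) ^ 2) μ)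
    (hc2 : opNorm (expMat (fun G => (G * Gᴴ) ^ 2) μ) ≤ c)
    {A : NCPoly m n} (hA : IsRowContraction A) :
    ∫ ω, trSq ((A.embed p).eval (inputs ω) - chop ((A.embed p).eval (inputs ω)))
      ∂(jointLaw m p μ) ≤
      c * (∑ i, trSq (A {i}) ^ 2) / 4 + 4 ^ m * (n : ℝ) ^ (m + 5) / √p := by
  have hq : ∀ q : Finset (Fin m) × Finset (Fin m), q ∈ smallPairs m →
      ¬ (q.1 = q.2 ∧ q.1.card ≤ 1) := fun q hq => (Finset.mem_filter.1 hq).2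
  choose! R hR hRb hRI using fun (q : Finset (Fin m) × Finset (Fin m)) (hq' : q ∈ smallPairs m) =>
    exists_integrable_bound (p := p) hμ hn h A hA.trSq_le q.1 q.2 (hq q hq')
  obtain ⟨hN, hNI⟩ := integral_trSq_sum_fluct_le hμ hc h2 hc2 (fun i : Fin m => A {i})
  have hN' : Integrable (fun ω => trSq (∑ i, fluct (A {i}) (ω.1 i)) / 4) (jointLaw m p μ) :=
    (hN.comp_fst (ν := Measure.pi fun _ : Fin m => haarUnitary p)).div_const 4
  have hR' : Integrable (fun ω => ∑ q ∈ smallPairs m, R q ω) (jointLaw m p μ) :=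
    integrable_finsetSum _ fun q hq => hR q hq
  have hpt : ∀ ω, trSq ((A.embed p).eval (inputs ω) - chop ((A.embed p).eval (inputs ω))) ≤
      trSq (∑ i, fluct (A {i}) (ω.1 i)) / 4 + ∑ q ∈ smallPairs m, R q ω := by
    intro ω
    refine (trSq_sub_chop_le_of_eq _ _ _ _ (eval_mul_conjTranspose h A ω)
      (hA.re_star_dotProduct_le h _)).trans ?_
    rw [trSq_embed h]
    refine add_le_add le_rfl ?_
    refine le_trans ?_ (Finset.sum_le_sum fun q hq => hRb q hq ω)
    simp only [Matrix.sum_apply]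
    rw [Finset.sum_comm (s := smallPairs m)]
    refine Finset.sum_le_sum fun a _ => ?_
    rw [Finset.sum_comm]
    exact Finset.sum_le_sum fun b _ => norm_sum_le _ _
  refine (integral_mono (integrable_trSq_sub_chop hμ h A) (hN'.add hR') hpt).trans ?_
  have h3 : ∫ ω, (trSq (∑ i, fluct (A {i}) (ω.1 i)) / 4 + ∑ q ∈ smallPairs m, R q ω)
      ∂(jointLaw m p μ) = (∫ x : Fin m → Mat n, trSq (∑ i, fluct (A {i}) (x i))
        ∂(Measure.pi fun _ => μ)) / 4 + ∑ q ∈ smallPairs m, ∫ ω, R q ω ∂(jointLaw m p μ) := by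
    rw [integral_add hN' hR', integral_div, integral_finsetSum _ fun q hq => hR q hq,
      integral_fst (fun x : Fin m → Mat n => trSq (∑ i, fluct (A {i}) (x i)))]
  refine (le_of_eq h3).trans (add_le_add (div_le_div_of_nonneg_right hNI (by norm_num)) ?_)
  refine (Finset.sum_le_sum fun q hq => hRI q hq).trans ?_
  rw [Finset.sum_const, nsmul_eq_mul, mul_div_assoc]
  refine mul_le_mul_of_nonneg_right ?_ (by positivity)
  have hcard : (smallPairs m).card ≤ 4 ^ m := by
    refine (Finset.card_le_univ _).trans_eq ?_
    rw [Fintype.card_prod, Fintype.card_finset, Fintype.card_fin, ← mul_pow]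
    norm_num
  exact_mod_cast hcard

end Truncation

/-! ### Polynomials of bounded functions on the cube -/

section Bounded

variable {m n p : ℕ} {f : (Fin m → ℤˣ) → Mat n}

lemma isRowContraction_polyOf (hf : ∀ σ, opNorm (f σ) ≤ 1) : IsRowContraction (polyOf f) :=
  sum_norm_sq_vecMul_fourierCoeff_le f hf

lemma norm_pow_le_one {ρ : ℝ} (hρ0 : 0 ≤ ρ) (hρ1 : ρ ≤ 1) (k : ℕ) : ‖(ρ : ℂ) ^ k‖ ^ 2 ≤ 1 := by
  rw [norm_pow, Complex.norm_real, Real.norm_of_nonneg hρ0]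
  exact pow_le_one₀ (by positivity) (pow_le_one₀ hρ0 hρ1)

lemma IsRowContraction.noise {A : NCPoly m n} (hA : IsRowContraction A) {ρ : ℝ} (hρ0 : 0 ≤ ρ)
    (hρ1 : ρ ≤ 1) : IsRowContraction (A.noise ρ) := by
  intro v
  refine (Finset.sum_le_sum fun S _ => Finset.sum_le_sum fun b _ => ?_).trans (hA v)
  rw [NCPoly.noise, Matrix.vecMul_smul, Pi.smul_apply, norm_smul, mul_pow]
  exact mul_le_of_le_one_left (by positivity) (norm_pow_le_one hρ0 hρ1 _)

lemma trSq_noise_le (A : NCPoly m n) {ρ : ℝ} (hρ0 : 0 ≤ ρ) (hρ1 : ρ ≤ 1) (S : Finset (Fin m)) :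
    trSq (A.noise ρ S) ≤ trSq (A S) := by
  rw [NCPoly.noise, trSq_smul]
  exact mul_le_of_le_one_left (trSq_nonneg _) (norm_pow_le_one hρ0 hρ1 _)

lemma trSq_fourierCoeff_le_maxInfluence {S : Finset (Fin m)} {i : Fin m} (hi : i ∈ S) :
    trSq (fourierCoeff f S) ≤ maxInfluence f := by
  have h1 : trSq (fourierCoeff f S) ≤ influence f i :=
    Finset.single_le_sum (f := fun S => trSq (fourierCoeff f S)) (fun _ _ => trSq_nonneg _)
      (by simpa using hi)
  exact h1.trans (le_ciSup (f := fun i => influence f i) (Set.finite_range _).bddAbove i)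

lemma sum_sq_trSq_noise_le (hf : ∀ σ, opNorm (f σ) ≤ 1) {ρ : ℝ} (hρ0 : 0 ≤ ρ) (hρ1 : ρ ≤ 1) :
    ∑ i, trSq ((polyOf f).noise ρ {i}) ^ 2 ≤ maxInfluence f * n := by
  set A := (polyOf f).noise ρ with hAdef
  have hA : IsRowContraction A := (isRowContraction_polyOf hf).noise hρ0 hρ1
  have hτ : ∀ i : Fin m, trSq (A {i}) ≤ maxInfluence f := fun i =>
    (trSq_noise_le _ hρ0 hρ1 _).trans
      (trSq_fourierCoeff_le_maxInfluence (Finset.mem_singleton_self i))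
  have h1 : ∑ i, trSq (A {i}) ≤ n := by
    refine le_trans ?_ hA.sum_trSq_le
    rw [← Finset.sum_image (g := fun i : Fin m => ({i} : Finset (Fin m)))
      (f := fun S => trSq (A S)) Finset.singleton_injective.injOn]
    exact Finset.sum_le_sum_of_subset_of_nonneg (Finset.subset_univ _) fun _ _ _ => trSq_nonneg _
  rcases Nat.eq_zero_or_pos m with rfl | hm
  · have h0 : 0 ≤ maxInfluence f := by simp [maxInfluence]
    simpa using mul_nonneg h0 (Nat.cast_nonneg n)
  have h0 : 0 ≤ maxInfluence f := (trSq_nonneg _).trans (hτ ⟨0, hm⟩)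
  calc ∑ i, trSq (A {i}) ^ 2 ≤ ∑ i, maxInfluence f * trSq (A {i}) := by
        refine Finset.sum_le_sum fun i _ => ?_
        rw [sq]
        exact mul_le_mul_of_nonneg_right (hτ i) (trSq_nonneg _)
    _ ≤ _ := by
        rw [← Finset.mul_sum]
        exact mul_le_mul_of_nonneg_left h1 h0

/-- If all influences vanish, only the constant coefficient survives, and it is a contraction. -/
lemma trSq_sub_chop_eq_zero (hf : ∀ σ, opNorm (f σ) ≤ 1) (h : n ≤ p) {ρ : ℝ} (hρ0 : 0 ≤ ρ)
    (hρ1 : ρ ≤ 1) (hτ : maxInfluence f = 0)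
    (ω : (Fin m → Mat n) × (Fin m → Matrix.unitaryGroup (Fin p) ℂ)) :
    trSq ((((polyOf f).noise ρ).embed p).eval (inputs ω) -
      chop ((((polyOf f).noise ρ).embed p).eval (inputs ω))) = 0 := by
  set A := (polyOf f).noise ρ with hAdef
  have hA : IsRowContraction A := (isRowContraction_polyOf hf).noise hρ0 hρ1
  have h1 : (A.embed p).eval (inputs ω) = polyTerm p A ∅ ω := by
    rw [eval_embed_inputs]
    refine Finset.sum_eq_single ∅ (fun S _ hS => ?_) (by simp)
    obtain ⟨i, hi⟩ := Finset.nonempty_iff_ne_empty.2 hS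
    have h2 : trSq (A S) = 0 := le_antisymm ((trSq_noise_le _ hρ0 hρ1 _).trans
      ((trSq_fourierCoeff_le_maxInfluence hi).trans_eq hτ)) (trSq_nonneg _)
    have h3 : A S = 0 := by
      open scoped Matrix.Norms.Frobenius in
      rw [trSq_eq_norm_sq] at h2
      open scoped Matrix.Norms.Frobenius in
      exact norm_eq_zero.1 (pow_eq_zero_iff two_ne_zero |>.1 h2)
    rw [polyTerm, h3, embed_zero, Matrix.zero_mul]
  rw [h1]
  refine le_antisymm ?_ (trSq_nonneg _)
  refine (trSq_sub_chop_le_of_eq _ (embed p (A ∅ * (A ∅)ᴴ)) 0 0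
    (by rw [term_empty_mul_conjTranspose h, add_zero, add_zero]) fun v => ?_).trans
    (by simp [trSq])
  simpa using hA.re_star_dotProduct_le h {∅} v

end Bounded

/-- `min(1, c τ / 4)` is at most `10 τ^e` for exponents `0 ≤ e ≤ 1 / c`, since `c^{1/c}` is bounded.
The error `ε` matters only for `c τ ≤ 1`, where `τ ≤ 1` and the negative power of `τ` is at least
`1`. -/
lemma min_one_le_rpow {c τ e x ε : ℝ} (hc : 1 ≤ c) (hτ : 0 < τ) (he0 : 0 ≤ e) (he : e ≤ 1 / c)
    (hx1 : x ≤ 1) (hx : x ≤ c * τ / 4 + ε) (hε : 0 ≤ ε) :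
    x ≤ 10 * τ ^ e + ε * τ ^ (-(1 / 3) : ℝ) := by
  have hc0 : 0 < c := by linarith
  have h1 : c ^ e ≤ 3 := by
    have h2 : c ^ e ≤ c ^ (1 / c) := Real.rpow_le_rpow_of_exponent_le hc he
    have h3 : c ^ (1 / c) ≤ Real.exp 1 := by
      rw [Real.rpow_def_of_pos hc0]
      refine Real.exp_le_exp.2 ?_
      rw [mul_one_div, div_le_one hc0]
      exact (Real.log_le_sub_one_of_pos hc0).trans (by linarith)
    linarith [Real.exp_one_lt_three]
  have hτe : 0 < τ ^ e := Real.rpow_pos_of_pos hτ e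
  have h4 : (c * τ) ^ e ≤ 3 * τ ^ e := by
    rw [Real.mul_rpow hc0.le hτ.le]
    exact mul_le_mul_of_nonneg_right h1 hτe.le
  rcases le_total 1 (c * τ) with h5 | h5
  · have h6 : 1 ≤ (c * τ) ^ e := Real.one_le_rpow h5 he0
    have h7 : 0 ≤ ε * τ ^ (-(1 / 3) : ℝ) := by positivity
    linarith
  · have h6 : c * τ ≤ (c * τ) ^ e := by
      have h7 := Real.rpow_le_rpow_of_exponent_ge (mul_pos hc0 hτ) h5
        (he.trans ((div_le_one hc0).2 hc))
      rwa [Real.rpow_one] at h7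
    have hτ1 : τ ≤ 1 := by nlinarith
    have h8 : 1 ≤ τ ^ (-(1 / 3) : ℝ) :=
      Real.one_le_rpow_of_pos_of_le_one_of_nonpos hτ hτ1 (by norm_num)
    have h9 : ε ≤ ε * τ ^ (-(1 / 3) : ℝ) := le_mul_of_one_le_right hε h8
    have h10 : 0 ≤ c * τ := by positivity
    linarith

end NCMajorization

end

theorem mainTheorem8 (m n : ℕ) (hm : 0 < m) (hn : 0 < n) :
    ∃ C : ℝ, 0 < C ∧
      ∀ (p : ℕ) (_ : n ≤ p)
        (μ : Measure (NCMajorization.Mat n)) (_ : NCMajorization.IsNormalizedLaw μ)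
        (c₂ c₃ : ℝ) (_ : 1 ≤ c₂) (_ : 1 ≤ c₃)
        (_ : NCMajorization.IntegrableMat (fun G => (G * Gᴴ) ^ 2) μ)
        (_ : NCMajorization.IntegrableMat (fun G => (G * Gᴴ) ^ 3) μ)
        (_ : NCMajorization.opNorm (NCMajorization.expMat (fun G => (G * Gᴴ) ^ 2) μ) ≤ c₂)
        (_ : NCMajorization.opNorm (NCMajorization.expMat (fun G => (G * Gᴴ) ^ 3) μ) ≤ c₃)
        (ρ : ℝ) (_ : 0 < ρ) (_ : ρ < 1)
        (f : (Fin m → ℤˣ) → NCMajorization.Mat n) (_ : ∀ σ, NCMajorization.opNorm (f σ) ≤ 1)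
        (τ : ℝ) (_ : τ = NCMajorization.maxInfluence f)
        (Q T : (Fin m → NCMajorization.Mat p) → NCMajorization.Mat p)
        (_ : Q = ((NCMajorization.polyOf f).embed p).eval)
        (_ : T = (((NCMajorization.polyOf f).noise ρ).embed p).eval),
        NCMajorization.FiniteL2 μ Q ∧
        (1 / (n : ℝ)) * NCMajorization.l2Norm μ Q ^ 2 ≤ 1 ∧
        NCMajorization.FiniteL2 μ (fun X => T X - NCMajorization.chop (T X)) ∧
        (1 / (n : ℝ)) * NCMajorization.l2Norm μ (fun X => T X - NCMajorization.chop (T X)) ^ 2 ≤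
          10 * (n : ℝ) ^ (1 / 2 : ℝ) * τ ^ ((1 - ρ) / (30 * (c₂ * c₃))) +
            C * (τ ^ (-(1 / 3) : ℝ) * (p : ℝ) ^ (-(1 / 2) : ℝ)) := by
  have hn0 : (0 : ℝ) < n := by exact_mod_cast hn
  have hn1 : (1 : ℝ) ≤ n := by exact_mod_cast hn
  refine ⟨4 ^ m * (n : ℝ) ^ (m + 5), by positivity, ?_⟩
  intro p hp μ hμ c₂ c₃ hc₂ hc₃ hi₂ _ ho₂ _ ρ hρ0 hρ1 f hf τ hτ Q T hQ hT
  have := hμ.isProbabilityMeasure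
  have hp0 : (0 : ℝ) < p := by exact_mod_cast (by omega : 0 < p)
  have hRQ := NCMajorization.isRowContraction_polyOf hf
  have hRT := hRQ.noise hρ0.le hρ1.le
  have hnorm : ∀ {x : ℝ}, 0 ≤ x → x ≤ n → 1 / (n : ℝ) * √x ^ 2 ≤ 1 := fun {x} hx0 hx => by
    rw [Real.sq_sqrt hx0, one_div_mul_eq_div, div_le_one hn0]; exact hx
  subst hQ hT
  have hF := NCMajorization.integrable_trSq_sub_chop hμ hp ((NCMajorization.polyOf f).noise ρ)
  refine ⟨NCMajorization.integrable_trSq_eval hμ hp _, ?_, hF, ?_⟩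
  · refine hnorm (integral_nonneg fun _ => NCMajorization.trSq_nonneg _) ?_
    exact (NCMajorization.integral_trSq_eval_le hμ hn hp _).trans hRQ.sum_trSq_le
  have hI0 : 0 ≤ ∫ ω, NCMajorization.trSq
      ((((NCMajorization.polyOf f).noise ρ).embed p).eval (NCMajorization.inputs ω) -
      NCMajorization.chop ((((NCMajorization.polyOf f).noise ρ).embed p).eval
        (NCMajorization.inputs ω))) ∂(NCMajorization.jointLaw m p μ) :=
    integral_nonneg fun _ => NCMajorization.trSq_nonneg _
  have hc : 0 < c₂ * c₃ := by positivity
  have he : 0 < (1 - ρ) / (30 * (c₂ * c₃)) := div_pos (by linarith) (by positivity)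
  have hτ0 : 0 ≤ τ := by
    rw [hτ]
    exact (NCMajorization.trSq_nonneg _).trans
      (NCMajorization.trSq_fourierCoeff_le_maxInfluence (Finset.mem_singleton_self ⟨0, hm⟩))
  -- For `τ = 0` the powers of `τ` on the right take the value `0`, so the left side has to vanish.
  rcases hτ0.eq_or_lt with h0 | hτ0
  · have hz := fun ω => NCMajorization.trSq_sub_chop_eq_zero hf hp hρ0.le hρ1.le
      (hτ.symm.trans h0.symm) ω
    rw [NCMajorization.l2Norm]
    simp only [hz]
    simp only [integral_zero, Real.sqrt_zero]
    rw [← h0]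
    have := Real.zero_rpow (x := (-(1 / 3) : ℝ)) (by norm_num)
    rw [this, Real.zero_rpow he.ne']
    simp
  · set I := ∫ ω, NCMajorization.trSq
      ((((NCMajorization.polyOf f).noise ρ).embed p).eval (NCMajorization.inputs ω) -
      NCMajorization.chop ((((NCMajorization.polyOf f).noise ρ).embed p).eval
        (NCMajorization.inputs ω))) ∂(NCMajorization.jointLaw m p μ) with hI
    have hI1 : I ≤ n := by
      refine (integral_mono hF (NCMajorization.integrable_trSq_eval hμ hp _) fun ω =>
        NCMajorization.trSq_sub_chop_le _).trans ?_
      exact (NCMajorization.integral_trSq_eval_le hμ hn hp _).trans hRT.sum_trSq_le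
    have hI2 : I ≤ c₂ * (τ * n) / 4 + 4 ^ m * (n : ℝ) ^ (m + 5) / √p := by
      refine (NCMajorization.integral_trSq_sub_chop_le hμ hn hp (by linarith) hi₂ ho₂ hRT).trans ?_
      have := NCMajorization.sum_sq_trSq_noise_le hf hρ0.le hρ1.le
      rw [← hτ] at this
      gcongr
    have hx : 1 / (n : ℝ) * √I ^ 2 ≤ c₂ * τ / 4 + 4 ^ m * (n : ℝ) ^ (m + 5) / √p := by
      rw [Real.sq_sqrt hI0, one_div_mul_eq_div, div_le_iff₀ hn0]
      refine hI2.trans ?_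
      have : 4 ^ m * (n : ℝ) ^ (m + 5) / √p ≤ 4 ^ m * (n : ℝ) ^ (m + 5) / √p * n :=
        le_mul_of_one_le_right (by positivity) hn1
      linarith
    have he1 : (1 - ρ) / (30 * (c₂ * c₃)) ≤ 1 / c₂ := by
      refine div_le_div₀ zero_le_one (by linarith) (by positivity) ?_
      nlinarith [mul_le_mul_of_nonneg_left hc₃ (show (0 : ℝ) ≤ c₂ by linarith)]
    refine (NCMajorization.min_one_le_rpow hc₂ hτ0 he.le he1 (hnorm hI0 hI1) hx
      (by positivity)).trans (add_le_add ?_ (le_of_eq ?_))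
    · refine mul_le_mul_of_nonneg_right ?_ (Real.rpow_nonneg hτ0.le _)
      exact le_mul_of_one_le_right (by norm_num) (Real.one_le_rpow hn1 (by norm_num))
    · rw [Real.rpow_neg hp0.le, Real.sqrt_eq_rpow]
      ring
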